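/- For $\alpha>0$ let $\mathbf X(\alpha)=(X_1,X_2,\dots)$ be a sequence of independent random variables in which $X_j$ is Poisson with mean $\alpha/j$, and let $$\mathcal L(\mathbf X(\alpha))=\Big\{\sum_{j\ge1} j x_j \;:\; x_j\in\mathbb Z,\ 0\le x_j\le X_j,\ x_j=0 \text{ for all but finitely many } j\Big\}\subseteq\mathbb N=\{0,1,2,\dots\}.$$ Let $\mathbf X^{(1)}(\alpha),\mathbf X^{(2)}(\alpha),\dots$ be independent copies of $\mathbf X(\alpha)$, and put $$s_\alpha=\inf\Big\{m\ge 1 \;:\; \mathbb P\Big[\bigcap_{i=1}^m\mathcal L(\mathbf X^{(i)}(\alpha))=\{0\}\Big]>0\Big\}\in\mathbb N\cup\{\infty\},\qquad \inf\emptyset=\infty.$$ Define $h:(0,\infty)\to\mathbb N\cup\{\infty\}$ by $$h(\alpha)=\begin{cases}\big\lceil (1-\alpha\log 2)^{-1}\big\rceil, & 0<\alpha<1/\log 2,\\ \infty, & \alpha\ge 1/\log 2,\end{cases}$$ where $\mathbb N\cup\{\infty\}$ carries its order topology. **Theorem.** Let $\alpha>0$. If $h$ is continuous at $\alpha$, then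 $s_\alpha=h(\alpha)$. If $h$ is discontinuous at $\alpha$, then $h(\alpha)\le s_\alpha\le h(\alpha)+1$. -/

import Mathlib

open MeasureTheory ProbabilityTheory

noncomputable section

/-- The sumset `L(X) = {∑ j ≥ 1, j * x j : 0 ≤ x j ≤ X j}` of a sequence `X = (X 1, X 2, …)` of
natural numbers. The values are natural numbers, so the sums are those of finitely supported `x`. -/
def sumset (X : ℕ+ → ℕ) : Set ℕ :=
  {n | ∃ x : ℕ+ →₀ ℕ, (∀ j, x j ≤ X j) ∧ n = x.sum fun j k => (j : ℕ) * k}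

/-- The law of `X(α) = (X 1, X 2, …)`, with independent coordinates and `X j` Poisson of
mean `α / j`. -/
def poissonSeqLaw (α : ℝ) : Measure (ℕ+ → ℕ) :=
  Measure.infinitePi fun j : ℕ+ => poissonMeasure (Real.toNNReal (α / (j : ℕ)))

instance (α : ℝ) : IsProbabilityMeasure (poissonSeqLaw α) := by
  unfold poissonSeqLaw; infer_instance

/-- The probability that the intersection of the sumsets of `m` independent copies of `X(α)`
is `{0}`. For `m = 0` the intersection is all of `ℕ`. -/
def trivialInterProb (α : ℝ) (m : ℕ) : ENNReal :=
  (Measure.pi fun _ : Fin m => poissonSeqLaw α)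
    {X : Fin m → ℕ+ → ℕ | (⋂ i, sumset (X i)) = {0}}

/-- `s_α`, the least `m` for which the intersection of `m` independent sumsets is `{0}` with
positive probability; it is `⊤` if there is no such `m`. -/
def sumsetNumber (α : ℝ) : ℕ∞ :=
  sInf {k : ℕ∞ | ∃ m : ℕ, k = (m : ℕ∞) ∧ 0 < trivialInterProb α m}

/-- `h(α) = ⌈1 / (1 - α log 2)⌉` for `0 < α < 1 / log 2` and `h(α) = ∞` for `α ≥ 1 / log 2`.
Only the values at `α > 0` matter. Continuity refers to the order topology of `ℕ∞`. -/
def hFun (α : ℝ) : ℕ∞ :=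
  if α < 1 / Real.log 2 then ((⌈(1 - α * Real.log 2)⁻¹⌉₊ : ℕ) : ℕ∞) else ⊤

end

/-!
A sequence `X(α)` has about `α log N` points (counted with multiplicity) up to `N`, so its sumset
has about `N ^ (α log 2)` elements up to `N`, and a given `n` belongs to it with probability about
`n ^ (α log 2 - 1)`. For `m` independent copies, `n` is a common element with probability about
`n ^ (-m (1 - α log 2))`, and everything depends on whether this is summable. Expected values are
dominated by sequences with unusually many points, so both directions restrict to sequences with
a typical number of points.

*If `m (1 - α log 2) > 1`, the intersection is `{0}` with positive probability*
(`trivialInterProb_pos`). Colour each point of `X(α)` red or blue with a fair coin; the red points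
form a copy of `X(α / 2)`. A sequence with at most `K` points up to `n` that has `n` in its sumset
gets red sum `n` with probability at least `2 ^ (-K)`. The red sum equals `n` with probability at
most `α / (2 n)` by the size-bias identity for Poisson variables (`mul_poissonPi_sum_eq_le`). Hence
`n` lies in the sumset, with at most `K` points present, with probability at most
`2 ^ K α / (2 n)`. With `K = σ log₂ n` for `σ` slightly above `α log 2`, Chernoff's bound and the
Borel–Cantelli lemma over dyadic blocks show that the intersection is almost surely finite. Letting
the first terms of all the sequences vanish, an event of positive probability that is independent
of the rest, removes its positive elements.

*If `m (1 - α log 2) < 1`, the intersection almost surely contains a positive integer*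
(`trivialInterProb_eq_zero`). Here it suffices to use the sets of indices `j` with `X j ≠ 0`, which
contain each `j` independently with probability `1 - exp (-α / j)`. In a window of indices in
`(2 ^ b₀, 2 ^ b₁]`, together with one more index of the order of `2 ^ b₁`, the second moment
method is applied to the number of common subset sums, weighted by the number of their
representations (`sq_sum_pow_le_second_moment`). What has to be bounded is the `ℓ ^ m` norm of the
law of the difference of two random subset sums. Two random subsets agree above `2 ^ b` with probability
`2 ^ (-count)`, about `2 ^ (-(b₁ - b) α log 2)` for typical sets, and the largest index at which they
differ, if of the order of `2 ^ b`, smooths the difference at that scale (`blockTerm_le`). Summing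
over the scales gives a geometric series, which converges towards the top scale exactly when
`m (1 - α log 2) < 1` (`sum_pow_sum_scales_le`). So each window succeeds with probability bounded
below (`exists_window`), and infinitely many disjoint windows are independent.

The theorem follows because the ceiling in the definition of `h` jumps just to the right of the
points where `1 / (1 - α log 2)` is an integer (`inv_lt_ceil_of_continuousAt`).
-/

namespace PoissonSumset

open Finset
open scoped NNReal ENNReal

/-! ### Random subsets of a finite set -/

/-- The probability that the random subset of `I` which contains each `j ∈ I` independently with
probability `p j` equals `A`. -/
noncomputable def bernWeight (p : ℕ → ℝ) (I A : Finset ℕ) : ℝ :=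
  (∏ j ∈ A, p j) * ∏ j ∈ I \ A, (1 - p j)

/-- The expectation of `F A`, where the random set `A ⊆ I` contains each `j ∈ I` independently
with probability `p j`. -/
noncomputable def bernExp (p : ℕ → ℝ) (I : Finset ℕ) (F : Finset ℕ → ℝ) : ℝ :=
  ∑ A ∈ I.powerset, bernWeight p I A * F A

lemma bernWeight_nonneg {p : ℕ → ℝ} (h0 : ∀ j, 0 ≤ p j) (h1 : ∀ j, p j ≤ 1) (I A : Finset ℕ) :
    0 ≤ bernWeight p I A :=
  mul_nonneg (prod_nonneg fun j _ => h0 j) (prod_nonneg fun j _ => sub_nonneg.2 (h1 j))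

lemma bernExp_empty (p : ℕ → ℝ) (F : Finset ℕ → ℝ) : bernExp p ∅ F = F ∅ := by
  simp [bernExp, bernWeight]

lemma bernExp_insert (p : ℕ → ℝ) {I : Finset ℕ} {a : ℕ} (ha : a ∉ I) (F : Finset ℕ → ℝ) :
    bernExp p (insert a I) F =
      (1 - p a) * bernExp p I F + p a * bernExp p I (fun A => F (insert a A)) := by
  unfold bernExp
  rw [sum_powerset_insert ha, mul_sum, mul_sum]
  congr 1
  · refine sum_congr rfl fun A hA => ?_
    have haA : a ∉ A := fun h => ha (mem_powerset.1 hA h)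
    have : insert a I \ A = insert a (I \ A) := by grind
    rw [bernWeight, bernWeight, this, prod_insert (by grind)]
    ring
  · refine sum_congr rfl fun A hA => ?_
    have haA : a ∉ A := fun h => ha (mem_powerset.1 hA h)
    have : insert a I \ insert a A = I \ A := by grind
    rw [bernWeight, bernWeight, this, prod_insert haA]
    ring

lemma bernExp_congr {p : ℕ → ℝ} {I : Finset ℕ} {F G : Finset ℕ → ℝ}
    (h : ∀ A, A ⊆ I → F A = G A) : bernExp p I F = bernExp p I G :=
  sum_congr rfl fun A hA => by rw [h A (mem_powerset.1 hA)]

lemma bernExp_mono {p : ℕ → ℝ} (h0 : ∀ j, 0 ≤ p j) (h1 : ∀ j, p j ≤ 1) {I : Finset ℕ}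
    {F G : Finset ℕ → ℝ} (h : ∀ A, A ⊆ I → F A ≤ G A) : bernExp p I F ≤ bernExp p I G :=
  sum_le_sum fun A hA =>
    mul_le_mul_of_nonneg_left (h A (mem_powerset.1 hA)) (bernWeight_nonneg h0 h1 I A)

lemma bernExp_add (p : ℕ → ℝ) (I : Finset ℕ) (F G : Finset ℕ → ℝ) :
    bernExp p I (fun A => F A + G A) = bernExp p I F + bernExp p I G := by
  simp only [bernExp, mul_add, sum_add_distrib]

lemma bernExp_mul (p : ℕ → ℝ) (I : Finset ℕ) (c : ℝ) (F : Finset ℕ → ℝ) :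
    bernExp p I (fun A => c * F A) = c * bernExp p I F := by
  simp only [bernExp, mul_sum]
  exact sum_congr rfl fun A _ => by ring

lemma bernExp_sum {ι : Type*} (p : ℕ → ℝ) (I : Finset ℕ) (s : Finset ι)
    (F : ι → Finset ℕ → ℝ) :
    bernExp p I (fun A => ∑ i ∈ s, F i A) = ∑ i ∈ s, bernExp p I (F i) := by
  simp only [bernExp, mul_sum]
  exact sum_comm

lemma bernExp_prod (p : ℕ → ℝ) (I : Finset ℕ) (f : ℕ → ℝ) :
    bernExp p I (fun A => ∏ j ∈ A, f j) = ∏ j ∈ I, (p j * f j + (1 - p j)) := by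
  rw [prod_add]
  refine sum_congr rfl fun A _ => ?_
  rw [bernWeight, prod_mul_distrib]
  ring

lemma bernExp_const (p : ℕ → ℝ) (I : Finset ℕ) (c : ℝ) : bernExp p I (fun _ => c) = c := by
  have h := bernExp_prod p I (fun _ => 1)
  have h2 := bernExp_mul p I c (fun _ => 1)
  simp only [prod_const_one, mul_one, add_sub_cancel] at h h2
  rw [h2, h, mul_one]

lemma bernExp_nonneg {p : ℕ → ℝ} (h0 : ∀ j, 0 ≤ p j) (h1 : ∀ j, p j ≤ 1) {I : Finset ℕ}
    {F : Finset ℕ → ℝ} (h : ∀ A, A ⊆ I → 0 ≤ F A) : 0 ≤ bernExp p I F :=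
  sum_nonneg fun A hA =>
    mul_nonneg (bernWeight_nonneg h0 h1 I A) (h A (mem_powerset.1 hA))

/-- The traces of the random set on disjoint sets `I` and `J` are independent. -/
lemma bernExp_union (p : ℕ → ℝ) {I J : Finset ℕ} (h : Disjoint I J) (F : Finset ℕ → ℝ) :
    bernExp p (I ∪ J) F = bernExp p I (fun A => bernExp p J (fun B => F (A ∪ B))) := by
  induction I using Finset.induction_on generalizing F with
  | empty => simp [bernExp_empty]
  | insert a I ha ih =>
    rw [disjoint_insert_left] at h
    rw [insert_union, bernExp_insert p (by simp [ha, h.1]), bernExp_insert p ha, ih h.2, ih h.2]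
    simp only [insert_union]

/-- The probability that the trace on `J` is empty bounds the cost of shrinking `I ∪ J` to `I`. -/
lemma mul_bernExp_le_bernExp_union {p : ℕ → ℝ} (h0 : ∀ j, 0 ≤ p j) (h1 : ∀ j, p j ≤ 1)
    {I J : Finset ℕ} (h : Disjoint I J) {F : Finset ℕ → ℝ} (hF : ∀ A, 0 ≤ F A) :
    (∏ j ∈ J, (1 - p j)) * bernExp p I F ≤ bernExp p (I ∪ J) F := by
  rw [bernExp_union p h, ← bernExp_mul]
  refine bernExp_mono h0 h1 fun A _ => ?_
  have := single_le_sum (f := fun B => bernWeight p J B * F (A ∪ B))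
    (fun B _ => mul_nonneg (bernWeight_nonneg h0 h1 J B) (hF _)) (empty_mem_powerset J)
  simpa [bernWeight, bernExp] using this

/-- Membership of `a` is independent of the trace below `a`. -/
lemma bernExp_mem_filter_lt (p : ℕ → ℝ) {I : Finset ℕ} {a : ℕ} (ha : a ∈ I)
    (F : Finset ℕ → ℝ) :
    bernExp p I (fun A => if a ∈ A then F (A.filter (· < a)) else 0) =
      p a * bernExp p (I.filter (· < a)) F := by
  have hI : I = insert a (I.filter (· < a) ∪ I.filter (a < ·)) := by grind
  have hd : Disjoint (I.filter (· < a)) (I.filter (a < ·)) := by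
    rw [Finset.disjoint_left]; grind
  have hn : a ∉ I.filter (· < a) ∪ I.filter (a < ·) := by grind
  conv_lhs => rw [hI]
  rw [bernExp_insert p hn, bernExp_congr (G := fun _ => 0) (fun A hA => by grind), bernExp_const,
    mul_zero, zero_add, bernExp_union p hd]
  congr 1
  refine bernExp_congr fun A hA => ?_
  rw [bernExp_congr (G := fun _ => F A), bernExp_const]
  intro B hB
  rw [if_pos (mem_insert_self _ _)]
  congr 1
  grind

lemma bernExp_sum_mem (p : ℕ → ℝ) (I : Finset ℕ) (v : ℕ → ℝ) :
    bernExp p I (fun A => ∑ j ∈ A, v j) = ∑ j ∈ I, p j * v j := by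
  have h : ∀ A, A ⊆ I → ∑ j ∈ A, v j = ∑ j ∈ I, (if j ∈ A then v j else 0) := by
    intro A hA
    rw [sum_ite_mem, inter_eq_right.2 hA]
  rw [bernExp_congr h, bernExp_sum]
  refine sum_congr rfl fun j hj => ?_
  rw [bernExp_mem_filter_lt p hj (fun _ => v j), bernExp_const]

/-! ### Random subset sums of a fixed set -/

/-- The probability that a uniformly random subset of `A` has sum `e`. -/
noncomputable def subsetSumProb (A : Finset ℕ) (e : ℤ) : ℝ :=
  (1 / 2) ^ #A * ∑ S ∈ A.powerset, if ∑ j ∈ S, (j : ℤ) = e then 1 else 0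

/-- The probability that the sums of two independent uniformly random subsets of `A` differ
by `d`. -/
noncomputable def subsetDiffProb (A : Finset ℕ) (d : ℤ) : ℝ :=
  (1 / 4) ^ #A * ∑ S ∈ A.powerset, ∑ T ∈ A.powerset,
    if ∑ j ∈ T, (j : ℤ) - ∑ j ∈ S, (j : ℤ) = d then 1 else 0

lemma subsetSumProb_nonneg (A : Finset ℕ) (e : ℤ) : 0 ≤ subsetSumProb A e := by
  unfold subsetSumProb; positivity

lemma subsetDiffProb_nonneg (A : Finset ℕ) (d : ℤ) : 0 ≤ subsetDiffProb A d := by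
  unfold subsetDiffProb; positivity

lemma exists_subset_of_subsetSumProb_ne_zero {A : Finset ℕ} {e : ℤ} (h : subsetSumProb A e ≠ 0) :
    ∃ S ⊆ A, ∑ j ∈ S, (j : ℤ) = e := by
  by_contra! hn
  refine h ?_
  rw [subsetSumProb, sum_eq_zero, mul_zero]
  intro S hS
  rw [if_neg (hn S (mem_powerset.1 hS))]

lemma subsetDiffProb_empty (d : ℤ) : subsetDiffProb ∅ d = if d = 0 then 1 else 0 := by
  simp only [subsetDiffProb, powerset_empty, sum_singleton, sum_empty, card_empty, pow_zero,
    one_mul, sub_self, eq_comm]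

lemma subsetDiffProb_insert {A : Finset ℕ} {a : ℕ} (ha : a ∉ A) (d : ℤ) :
    subsetDiffProb (insert a A) d = 1 / 2 * subsetDiffProb A d +
      1 / 4 * (subsetDiffProb A (d - a) + subsetDiffProb A (d + a)) := by
  have hs : ∀ S ∈ A.powerset, ∑ j ∈ insert a S, (j : ℤ) = a + ∑ j ∈ S, (j : ℤ) :=
    fun S hS => sum_insert fun h => ha (mem_powerset.1 hS h)
  unfold subsetDiffProb
  rw [card_insert_of_notMem ha, sum_powerset_insert ha]
  have e1 : ∀ S ∈ A.powerset, (∑ T ∈ (insert a A).powerset,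
      if ∑ j ∈ T, (j : ℤ) - ∑ j ∈ S, (j : ℤ) = d then (1 : ℝ) else 0) =
      (∑ T ∈ A.powerset, if ∑ j ∈ T, (j : ℤ) - ∑ j ∈ S, (j : ℤ) = d then (1 : ℝ) else 0) +
      ∑ T ∈ A.powerset, if ∑ j ∈ T, (j : ℤ) - ∑ j ∈ S, (j : ℤ) = d - a then (1 : ℝ) else 0 := by
    intro S hS
    rw [sum_powerset_insert ha]
    congr 1
    refine sum_congr rfl fun T hT => ?_
    rw [hs T hT]
    exact if_congr (by constructor <;> intro h <;> linarith) rfl rfl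
  have e2 : ∀ S ∈ A.powerset, (∑ T ∈ (insert a A).powerset,
      if ∑ j ∈ T, (j : ℤ) - ∑ j ∈ insert a S, (j : ℤ) = d then (1 : ℝ) else 0) =
      (∑ T ∈ A.powerset, if ∑ j ∈ T, (j : ℤ) - ∑ j ∈ S, (j : ℤ) = d + a then (1 : ℝ) else 0) +
      ∑ T ∈ A.powerset, if ∑ j ∈ T, (j : ℤ) - ∑ j ∈ S, (j : ℤ) = d then (1 : ℝ) else 0 := by
    intro S hS
    rw [sum_powerset_insert ha, hs S hS]
    congr 1
    · refine sum_congr rfl fun T hT => ?_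
      exact if_congr (by constructor <;> intro h <;> linarith) rfl rfl
    · refine sum_congr rfl fun T hT => ?_
      rw [hs T hT]
      exact if_congr (by constructor <;> intro h <;> linarith) rfl rfl
  rw [sum_congr rfl e1, sum_congr rfl e2, sum_add_distrib, sum_add_distrib, pow_succ]
  ring

/-- Two independent uniformly random subsets of `A` either agree, or there is a largest `j ∈ A` on
which they disagree; the sum in the statement is over this `j`. -/
lemma subsetDiffProb_expand (A : Finset ℕ) (d : ℤ) :
    subsetDiffProb A d = (1 / 2) ^ #A * (if d = 0 then 1 else 0) +
      ∑ j ∈ A, (1 / 2) ^ #(A.filter (j < ·)) * (1 / 4 *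
        (subsetDiffProb (A.filter (· < j)) (d - j) +
          subsetDiffProb (A.filter (· < j)) (d + j))) := by
  induction A using Finset.induction_on_max with
  | empty => simp [subsetDiffProb_empty]
  | insert a A hA ih =>
    have ha : a ∉ A := fun h => lt_irrefl _ (hA a h)
    rw [subsetDiffProb_insert ha, ih, card_insert_of_notMem ha, sum_insert ha]
    have e1 : (insert a A).filter (a < ·) = ∅ := by
      ext x; simp only [mem_filter, mem_insert, notMem_empty, iff_false]; grind
    have e2 : (insert a A).filter (· < a) = A := by grind
    have e3 : ∀ j ∈ A, #((insert a A).filter (j < ·)) = #(A.filter (j < ·)) + 1 := by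
      intro j hj
      rw [filter_insert, if_pos (hA j hj), card_insert_of_notMem (by grind)]
    have e4 : ∀ j ∈ A, (insert a A).filter (· < j) = A.filter (· < j) := by
      intro j hj
      rw [filter_insert, if_neg (not_lt.2 (hA j hj).le)]
    rw [e1, e2, card_empty, ← ih]
    rw [sum_congr rfl fun j hj => by rw [e3 j hj, e4 j hj, pow_succ, mul_assoc, mul_left_comm],
      ← mul_sum]
    conv_lhs => rw [ih]
    ring

lemma sum_ite_eq_le_one {ι : Type*} (s : Finset ι) {g : ι → ℤ} (hg : Set.InjOn g s) (x : ℤ) :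
    ∑ i ∈ s, (if x = g i then (1 : ℝ) else 0) ≤ 1 := by
  rw [sum_boole]
  exact_mod_cast card_le_one.2 fun a ha b hb => by
    simp only [mem_filter] at ha hb
    exact hg ha.1 hb.1 (ha.2.symm.trans hb.2)

/-- Distinct values of the difference correspond to disjoint events. -/
lemma sum_subsetDiffProb_le_one {ι : Type*} (A : Finset ℕ) (s : Finset ι) {g : ι → ℤ}
    (hg : Set.InjOn g s) : ∑ i ∈ s, subsetDiffProb A (g i) ≤ 1 := by
  unfold subsetDiffProb
  rw [← mul_sum, sum_comm]
  simp_rw [sum_comm (s := s)]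
  calc _ ≤ (1 / 4 : ℝ) ^ #A * ∑ S ∈ A.powerset, ∑ T ∈ A.powerset, 1 := by
        gcongr
        exact sum_ite_eq_le_one s hg _
    _ = 1 := by
        simp only [sum_const, card_powerset, nsmul_eq_mul, mul_one]
        push_cast
        rw [← mul_assoc, ← mul_pow, ← mul_pow]
        norm_num

lemma sum_subsetSumProb_mul_le (A J : Finset ℕ) (n n' : ℤ) :
    ∑ u ∈ J, subsetSumProb A (n - u) * subsetSumProb A (n' - u) ≤ subsetDiffProb A (n' - n) := by
  have h : ∀ u ∈ J, subsetSumProb A (n - u) * subsetSumProb A (n' - u) =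
      (1 / 4) ^ #A * ∑ S ∈ A.powerset, ∑ T ∈ A.powerset,
        (if ∑ j ∈ S, (j : ℤ) = n - u then 1 else 0) *
          (if ∑ j ∈ T, (j : ℤ) = n' - u then 1 else 0) := by
    intro u _
    rw [subsetSumProb, subsetSumProb, mul_mul_mul_comm, ← mul_pow, sum_mul_sum]
    norm_num
  rw [sum_congr rfl h, ← mul_sum, subsetDiffProb, sum_comm]
  simp_rw [sum_comm (s := J)]
  gcongr with S hS T hT
  split_ifs with hd
  · calc _ ≤ ∑ u ∈ J, (if n - ∑ j ∈ S, (j : ℤ) = (u : ℤ) then (1 : ℝ) else 0) := by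
          refine sum_le_sum fun u _ => ?_
          split_ifs <;> first | (exfalso; omega) | norm_num
      _ ≤ 1 := sum_ite_eq_le_one J (fun a _ b _ h => by exact_mod_cast h) _
  · refine (sum_eq_zero fun u _ => ?_).le
    split_ifs <;> first | (exfalso; omega) | norm_num

lemma sum_subsetSumProb_eq_one (A J : Finset ℕ) (n : ℤ)
    (h : ∀ S ⊆ A, ∃ u ∈ J, (u : ℤ) = n - ∑ j ∈ S, (j : ℤ)) :
    ∑ u ∈ J, subsetSumProb A (n - u) = 1 := by
  unfold subsetSumProb
  rw [← mul_sum, sum_comm]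
  have : ∀ S ∈ A.powerset, ∑ u ∈ J, (if ∑ j ∈ S, (j : ℤ) = n - u then (1 : ℝ) else 0) = 1 := by
    intro S hS
    obtain ⟨u, hu, hu'⟩ := h S (mem_powerset.1 hS)
    rw [sum_eq_single u, if_pos (by linarith)]
    · intro v _ hv
      exact if_neg fun h => hv (by exact_mod_cast (by linarith : (v : ℤ) = u))
    · exact fun h => absurd hu h
  rw [sum_congr rfl this]
  simp

/-! ### The law of the difference of two random subset sums -/

/-- The probability that a Poisson variable of mean `α / j` is nonzero. -/
noncomputable def hitProb (α : ℝ) (j : ℕ) : ℝ := 1 - Real.exp (-(α / j))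

lemma hitProb_nonneg {α : ℝ} (hα : 0 ≤ α) (j : ℕ) : 0 ≤ hitProb α j := by
  have : 0 ≤ α / j := by positivity
  have := Real.exp_le_one_iff.2 (neg_nonpos.2 this)
  unfold hitProb; linarith

lemma hitProb_le_one (α : ℝ) (j : ℕ) : hitProb α j ≤ 1 := by
  have := Real.exp_pos (-(α / j))
  unfold hitProb; linarith

lemma hitProb_le_div (α : ℝ) (j : ℕ) : hitProb α j ≤ α / j := by
  have := Real.add_one_le_exp (-(α / j))
  unfold hitProb; linarith

lemma div_one_add_div_le_hitProb {α : ℝ} (hα : 0 ≤ α) (j : ℕ) :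
    α / j / (1 + α / j) ≤ hitProb α j := by
  have h1 : Real.exp (-(α / j)) ≤ 1 / (1 + α / j) := by
    rw [Real.exp_neg, ← one_div]
    have := Real.add_one_le_exp (α / j)
    exact one_div_le_one_div_of_le (by positivity) (by linarith)
  have h2 : α / j / (1 + α / j) = 1 - 1 / (1 + α / j) := by field_simp; ring
  rw [h2, hitProb]
  linarith

/-- No element of a set of at most `Y` integers above `Y` is hit with probability bounded below. -/
lemma exp_neg_le_prod_one_sub_hitProb {α : ℝ} (hα : 0 ≤ α) {J : Finset ℕ} {Y : ℕ} (hY : 0 < Y)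
    (hJ : ∀ j ∈ J, Y ≤ j) (hc : #J ≤ Y) : Real.exp (-α) ≤ ∏ j ∈ J, (1 - hitProb α j) := by
  simp only [hitProb, sub_sub_cancel]
  rw [← Real.exp_sum, Real.exp_le_exp, sum_neg_distrib, neg_le_neg_iff]
  have hY' : (0 : ℝ) < Y := by exact_mod_cast hY
  calc ∑ j ∈ J, α / j ≤ ∑ j ∈ J, α / Y := by
        refine sum_le_sum fun j hj => ?_
        have : (Y : ℝ) ≤ j := by exact_mod_cast hJ j hj
        gcongr
    _ = #J * (α / Y) := by simp
    _ ≤ Y * (α / Y) := by gcongr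
    _ = α := by field_simp

lemma sum_Ioc_two_pow {b₀ b₁ : ℕ} (h : b₀ ≤ b₁) (f : ℕ → ℝ) :
    ∑ j ∈ Ioc (2 ^ b₀) (2 ^ b₁), f j =
      ∑ b ∈ Ico b₀ b₁, ∑ j ∈ Ioc (2 ^ b) (2 ^ (b + 1)), f j := by
  induction b₁, h using Nat.le_induction with
  | base => simp
  | succ b hb ih =>
    rw [sum_Ico_succ_top hb, ← ih, sum_Ioc_consecutive _ (Nat.pow_le_pow_right two_pos hb)
      (Nat.pow_le_pow_right two_pos (Nat.le_succ b))]

/-- The expected number, over the random set of indices above `2 ^ b₀`, of `j` in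
`(2 ^ b, 2 ^ (b + 1)]` for which two random subset sums differ by `d` when the two subsets differ
at `j` and only the elements up to `j` are counted. -/
noncomputable def blockTerm (α : ℝ) (b₀ b : ℕ) (d : ℤ) : ℝ :=
  ∑ j ∈ Ioc (2 ^ b) (2 ^ (b + 1)), hitProb α j * (1 / 4 *
    (bernExp (hitProb α) (Ioo (2 ^ b₀) j) (fun A => subsetDiffProb A (d - j)) +
      bernExp (hitProb α) (Ioo (2 ^ b₀) j) (fun A => subsetDiffProb A (d + j))))

lemma bernExp_subsetDiffProb_nonneg {α : ℝ} (hα : 0 ≤ α) (I : Finset ℕ) (d : ℤ) :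
    0 ≤ bernExp (hitProb α) I (fun A => subsetDiffProb A d) :=
  bernExp_nonneg (hitProb_nonneg hα) (hitProb_le_one α) fun A _ => subsetDiffProb_nonneg A d

lemma sum_bernExp_subsetDiffProb_le_one {ι : Type*} {α : ℝ} (hα : 0 ≤ α) (I : Finset ℕ)
    (s : Finset ι) {g : ι → ℤ} (hg : Set.InjOn g s) :
    ∑ i ∈ s, bernExp (hitProb α) I (fun A => subsetDiffProb A (g i)) ≤ 1 := by
  rw [← bernExp_sum, ← bernExp_const (hitProb α) I 1]
  exact bernExp_mono (hitProb_nonneg hα) (hitProb_le_one α)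
    fun A _ => sum_subsetDiffProb_le_one A s hg

lemma blockTerm_nonneg {α : ℝ} (hα : 0 ≤ α) (b₀ b : ℕ) (d : ℤ) : 0 ≤ blockTerm α b₀ b d :=
  sum_nonneg fun j _ => mul_nonneg (hitProb_nonneg hα j) (mul_nonneg (by norm_num)
    (add_nonneg (bernExp_subsetDiffProb_nonneg hα _ _) (bernExp_subsetDiffProb_nonneg hα _ _)))

/-- The position of the largest discrepancy smooths the law of the difference at scale `2 ^ b`. -/
lemma blockTerm_le {α : ℝ} (hα : 0 ≤ α) {b₀ b : ℕ} (hb : b₀ ≤ b) (d : ℤ) :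
    blockTerm α b₀ b d ≤ α * Real.exp α / 2 / 2 ^ b := by
  set p := hitProb α
  set E : ℤ → ℝ := fun e => bernExp p (Ioc (2 ^ b₀) (2 ^ (b + 1))) (fun A => subsetDiffProb A e)
    with hE
  have hpow : 2 ^ b₀ ≤ 2 ^ b := Nat.pow_le_pow_right two_pos hb
  -- The indices in `[j, 2 ^ (b + 1)]` are all absent with probability at least `exp (-α)`, so the
  -- laws for different `j` are dominated by a single one.
  have key : ∀ j ∈ Ioc (2 ^ b) (2 ^ (b + 1)), ∀ e,
      bernExp p (Ioo (2 ^ b₀) j) (fun A => subsetDiffProb A e) ≤ Real.exp α * E e := by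
    intro j hj e
    rw [mem_Ioc] at hj
    have hu : Ioc (2 ^ b₀) (2 ^ (b + 1)) = Ioo (2 ^ b₀) j ∪ Icc j (2 ^ (b + 1)) := by
      ext x; simp only [mem_Ioc, mem_union, mem_Ioo, mem_Icc]; omega
    have hd : Disjoint (Ioo (2 ^ b₀) j) (Icc j (2 ^ (b + 1))) := by
      rw [Finset.disjoint_left]; intro x; simp only [mem_Ioo, mem_Icc]; omega
    have h1 := mul_bernExp_le_bernExp_union (hitProb_nonneg hα) (hitProb_le_one α) hd
      (F := fun A => subsetDiffProb A e) (fun A => subsetDiffProb_nonneg A e)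
    have h2 := exp_neg_le_prod_one_sub_hitProb hα (J := Icc j (2 ^ (b + 1))) (Y := 2 ^ b)
      (by positivity) (fun i hi => by rw [mem_Icc] at hi; omega)
      (by rw [Nat.card_Icc, pow_succ]; omega)
    rw [← hu] at h1
    have h3 := (mul_le_mul_of_nonneg_right h2
      (bernExp_subsetDiffProb_nonneg hα (Ioo (2 ^ b₀) j) e)).trans h1
    calc _ = Real.exp α * (Real.exp (-α) *
          bernExp p (Ioo (2 ^ b₀) j) (fun A => subsetDiffProb A e)) := by
            rw [← mul_assoc, ← Real.exp_add]; simp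
      _ ≤ _ := by gcongr
  have hE0 : ∀ e, 0 ≤ E e := fun e => bernExp_subsetDiffProb_nonneg hα _ e
  calc blockTerm α b₀ b d
      ≤ ∑ j ∈ Ioc (2 ^ b : ℕ) (2 ^ (b + 1)), α / 2 ^ b * (1 / 4 *
          (Real.exp α * E (d - j) + Real.exp α * E (d + j))) := by
        unfold blockTerm
        refine sum_le_sum fun j hj => ?_
        have hj' : (2 : ℝ) ^ b ≤ j := by
          rw [mem_Ioc] at hj; exact_mod_cast hj.1.le
        have hp : p j ≤ α / 2 ^ b := (hitProb_le_div α j).trans (by gcongr)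
        have := bernExp_subsetDiffProb_nonneg hα (Ioo (2 ^ b₀) j) (d - j)
        have := bernExp_subsetDiffProb_nonneg hα (Ioo (2 ^ b₀) j) (d + j)
        have := key j hj (d - j)
        have := key j hj (d + j)
        gcongr
    _ = α * Real.exp α / 4 / 2 ^ b * (∑ j ∈ Ioc (2 ^ b : ℕ) (2 ^ (b + 1)), E (d - j) +
          ∑ j ∈ Ioc (2 ^ b : ℕ) (2 ^ (b + 1)), E (d + j)) := by
        rw [← sum_add_distrib, mul_sum]
        exact sum_congr rfl fun j _ => by ring
    _ ≤ α * Real.exp α / 4 / 2 ^ b * (1 + 1) := by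
        gcongr
        · exact sum_bernExp_subsetDiffProb_le_one hα _ _ (g := fun j : ℕ => d - j)
            fun x _ y _ h => by simpa using h
        · exact sum_bernExp_subsetDiffProb_le_one hα _ _ (g := fun j : ℕ => d + j)
            fun x _ y _ h => by simpa using h
    _ = _ := by ring

lemma sum_blockTerm_le {α : ℝ} (hα : 0 ≤ α) (b₀ b : ℕ) (D : Finset ℤ) :
    ∑ d ∈ D, blockTerm α b₀ b d ≤ α / 2 := by
  unfold blockTerm
  rw [sum_comm]
  calc _ ≤ ∑ j ∈ Ioc (2 ^ b) (2 ^ (b + 1)), α / 2 ^ b * (1 / 4 * (1 + 1)) := by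
        refine sum_le_sum fun j hj => ?_
        have hj' : (2 : ℝ) ^ b ≤ j := by
          rw [mem_Ioc] at hj; exact_mod_cast hj.1.le
        have hp : hitProb α j ≤ α / 2 ^ b := (hitProb_le_div α j).trans (by gcongr)
        rw [← mul_sum, ← mul_sum, sum_add_distrib]
        have h1 := sum_bernExp_subsetDiffProb_le_one hα (Ioo (2 ^ b₀) j) D
          (g := fun d => d - j) fun x _ y _ h => by simpa using h
        have h2 := sum_bernExp_subsetDiffProb_le_one hα (Ioo (2 ^ b₀) j) D
          (g := fun d => d + j) fun x _ y _ h => by simpa using h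
        have h3 : 0 ≤ ∑ d ∈ D, bernExp (hitProb α) (Ioo (2 ^ b₀) j)
          (fun A => subsetDiffProb A (d - j)) :=
            sum_nonneg fun d _ => bernExp_subsetDiffProb_nonneg hα _ _
        have h4 : 0 ≤ ∑ d ∈ D, bernExp (hitProb α) (Ioo (2 ^ b₀) j)
          (fun A => subsetDiffProb A (d + j)) :=
            sum_nonneg fun d _ => bernExp_subsetDiffProb_nonneg hα _ _
        gcongr
    _ = α / 2 := by
        rw [sum_const, Nat.card_Ioc, pow_succ, mul_two, Nat.add_sub_cancel]
        simp only [nsmul_eq_mul]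
        push_cast
        field_simp
        ring

/-- A set is well spread if, for each `b`, it has so many elements above `2 ^ b` that a uniformly
random subset agrees with a given one above `2 ^ b` with probability at most `K τ ^ (b₁ - b)`. -/
def WellSpread (K τ : ℝ) (b₀ b₁ : ℕ) (A : Finset ℕ) : Prop :=
  ∀ b ∈ Icc b₀ b₁, (1 / 2 : ℝ) ^ #(A.filter (2 ^ b < ·)) ≤ K * τ ^ (b₁ - b)

open Classical in
lemma bernExp_wellSpread_subsetDiffProb_le {α : ℝ} (hα : 0 ≤ α) {K τ : ℝ} (hK : 0 ≤ K)
    (hτ : 0 ≤ τ) {b₀ b₁ : ℕ} (hb : b₀ ≤ b₁) (d : ℤ) :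
    bernExp (hitProb α) (Ioc (2 ^ b₀) (2 ^ b₁))
      (fun A => if WellSpread K τ b₀ b₁ A then subsetDiffProb A d else 0) ≤
    K * τ ^ (b₁ - b₀) * (if d = 0 then 1 else 0) +
      K * ∑ b ∈ Ico b₀ b₁, τ ^ (b₁ - (b + 1)) * blockTerm α b₀ b d := by
  set I := Ioc (2 ^ b₀) (2 ^ b₁) with hI
  set F : ℕ → Finset ℕ → ℝ := fun j A => 1 / 4 *
    (subsetDiffProb A (d - j) + subsetDiffProb A (d + j)) with hF
  have hF0 : ∀ j A, 0 ≤ F j A := fun j A => mul_nonneg (by norm_num)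
    (add_nonneg (subsetDiffProb_nonneg _ _) (subsetDiffProb_nonneg _ _))
  have hpt : ∀ A, A ⊆ I → (if WellSpread K τ b₀ b₁ A then subsetDiffProb A d else 0) ≤
      K * τ ^ (b₁ - b₀) * (if d = 0 then 1 else 0) +
      K * ∑ b ∈ Ico b₀ b₁, τ ^ (b₁ - (b + 1)) * ∑ j ∈ Ioc (2 ^ b) (2 ^ (b + 1)),
        (if j ∈ A then F j (A.filter (· < j)) else 0) := by
    intro A hA
    by_cases hW : WellSpread K τ b₀ b₁ A
    swap
    · rw [if_neg hW]
      have : 0 ≤ ∑ b ∈ Ico b₀ b₁, τ ^ (b₁ - (b + 1)) * ∑ j ∈ Ioc (2 ^ b) (2 ^ (b + 1)),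
          (if j ∈ A then F j (A.filter (· < j)) else 0) :=
        sum_nonneg fun b _ => mul_nonneg (by positivity) (sum_nonneg fun j _ => by
          split_ifs <;> simp [hF0])
      positivity
    have hfull : (1 / 2 : ℝ) ^ #A ≤ K * τ ^ (b₁ - b₀) := by
      have := hW b₀ (left_mem_Icc.2 hb)
      rwa [filter_true_of_mem fun j hj => (mem_Ioc.1 (hA hj)).1] at this
    rw [if_pos hW, subsetDiffProb_expand]
    refine add_le_add (mul_le_mul_of_nonneg_right hfull (by positivity)) ?_
    have hsum : ∑ j ∈ A, (1 / 2 : ℝ) ^ #(A.filter (j < ·)) * F j (A.filter (· < j)) =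
        ∑ b ∈ Ico b₀ b₁, ∑ j ∈ Ioc (2 ^ b) (2 ^ (b + 1)), (if j ∈ A then
          (1 / 2 : ℝ) ^ #(A.filter (j < ·)) * F j (A.filter (· < j)) else 0) := by
      rw [← sum_Ioc_two_pow hb, sum_ite_mem, inter_eq_right.2 hA]
    rw [hsum, mul_sum]
    refine sum_le_sum fun b hb' => ?_
    rw [mul_sum, mul_sum]
    refine sum_le_sum fun j hj => ?_
    split_ifs with hjA
    · rw [mem_Ico] at hb'
      rw [mem_Ioc] at hj
      have h1 := hW (b + 1) (mem_Icc.2 ⟨by omega, by omega⟩)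
      have h2 : (1 / 2 : ℝ) ^ #(A.filter (j < ·)) ≤
          (1 / 2) ^ #(A.filter (2 ^ (b + 1) < ·)) :=
        pow_le_pow_of_le_one (by norm_num) (by norm_num) (card_le_card fun x hx => by
          simp only [mem_filter] at hx ⊢
          exact ⟨hx.1, by omega⟩)
      change _ ≤ K * (τ ^ (b₁ - (b + 1)) * F j (A.filter (· < j)))
      rw [← mul_assoc K]
      exact mul_le_mul_of_nonneg_right (h2.trans h1) (hF0 _ _)
    · simp
  refine (bernExp_mono (hitProb_nonneg hα) (hitProb_le_one α) hpt).trans_eq ?_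
  rw [bernExp_add, bernExp_const, bernExp_mul, bernExp_sum]
  congr 2
  refine sum_congr rfl fun b hb' => ?_
  rw [bernExp_mul, bernExp_sum, blockTerm]
  congr 1
  refine sum_congr rfl fun j hj => ?_
  have hjI : j ∈ I := by
    rw [mem_Ico] at hb'
    rw [mem_Ioc] at hj
    rw [hI, mem_Ioc]
    have := Nat.pow_le_pow_right two_pos hb'.1
    have := Nat.pow_le_pow_right two_pos (Nat.succ_le_of_lt hb'.2)
    omega
  have hIoo : I.filter (· < j) = Ioo (2 ^ b₀) j := by
    ext x; rw [mem_filter, hI, mem_Ioc, mem_Ioo]; rw [hI, mem_Ioc] at hjI; omega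
  rw [bernExp_mem_filter_lt (hitProb α) hjI (F j), hIoo, hF, bernExp_mul, bernExp_add]

/-- Jensen's inequality for the weights `w`. -/
lemma sum_pow_succ_le_weighted {ι : Type*} (s : Finset ι) {w x : ι → ℝ} (hw : ∀ i ∈ s, 0 < w i)
    (hx : ∀ i ∈ s, 0 ≤ x i) (k : ℕ) :
    (∑ i ∈ s, x i) ^ (k + 1) ≤ (∑ i ∈ s, w i) ^ k * ∑ i ∈ s, x i ^ (k + 1) / w i ^ k := by
  rcases s.eq_empty_or_nonempty with rfl | hs
  · simp
  set W := ∑ i ∈ s, w i with hW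
  have hW0 : 0 < W := sum_pos hw hs
  have h := Real.pow_arith_mean_le_arith_mean_pow s (fun i => w i / W)
    (fun i => x i * W / w i) (fun i hi => div_nonneg (hw i hi).le hW0.le)
    (by rw [← sum_div, div_self hW0.ne'])
    (fun i hi => div_nonneg (mul_nonneg (hx i hi) hW0.le) (hw i hi).le) (k + 1)
  have e1 : ∑ i ∈ s, w i / W * (x i * W / w i) = ∑ i ∈ s, x i :=
    sum_congr rfl fun i hi => by
      have := (hw i hi).ne'
      field_simp
  have e2 : ∑ i ∈ s, w i / W * (x i * W / w i) ^ (k + 1) =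
      W ^ k * ∑ i ∈ s, x i ^ (k + 1) / w i ^ k := by
    rw [mul_sum]
    refine sum_congr rfl fun i hi => ?_
    have := (hw i hi).ne'
    rw [div_pow, mul_pow]
    field_simp
    ring
  rwa [e1, e2] at h

/-- Interpolation between the supremum and the sum of each `t b`. The condition on `a` makes the
contributions of the scales decay geometrically away from the top scale `b₁`. -/
lemma sum_pow_sum_scales_le {k : ℕ} {τ a C₁ C₂ : ℝ} (hτ : 0 ≤ τ) (ha0 : 0 < a) (ha1 : a < 1)
    (hC₁ : 0 ≤ C₁) (hak : a ^ (k + 1) = τ ^ (k + 1) * 2 ^ k) (D : Finset ℤ) {b₀ b₁ : ℕ}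
    (t : ℕ → ℤ → ℝ) (ht : ∀ b d, 0 ≤ t b d) (h1 : ∀ b, b₀ ≤ b → ∀ d, t b d ≤ C₁ / 2 ^ b)
    (h2 : ∀ b, ∑ d ∈ D, t b d ≤ C₂) :
    ∑ d ∈ D, (∑ b ∈ Ico b₀ b₁, τ ^ (b₁ - (b + 1)) * t b d) ^ (k + 1) ≤
      (1 / (1 - a)) ^ (k + 1) * ((2 * C₁ / 2 ^ b₁) ^ k * C₂) := by
  have hC₂ : 0 ≤ C₂ := (sum_nonneg fun d _ => ht 0 d).trans (h2 0)
  have hgeom : ∑ b ∈ Ico b₀ b₁, a ^ (b₁ - (b + 1)) ≤ 1 / (1 - a) := by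
    calc _ ≤ ∑ b ∈ range b₁, a ^ (b₁ - (b + 1)) := by
          refine sum_le_sum_of_subset_of_nonneg (fun x hx => ?_) fun _ _ _ => by positivity
          simp only [mem_Ico, mem_range] at *; omega
      _ = ∑ i ∈ range b₁, a ^ i := by
          rw [← sum_range_reflect]
          refine sum_congr rfl fun i hi => ?_
          rw [mem_range] at hi
          congr 1; omega
      _ ≤ 1 / (1 - a) := by
          rw [one_div, ← tsum_geometric_of_lt_one ha0.le ha1]
          exact (summable_geometric_of_lt_one ha0.le ha1).sum_le_tsum _
            fun _ _ => by positivity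
  have hone : ∀ b ∈ Ico b₀ b₁, ∑ d ∈ D, (τ ^ (b₁ - (b + 1)) * t b d) ^ (k + 1) /
      (a ^ (b₁ - (b + 1))) ^ k ≤ a ^ (b₁ - (b + 1)) * ((2 * C₁ / 2 ^ b₁) ^ k * C₂) := by
    intro b hb
    rw [mem_Ico] at hb
    obtain ⟨i, rfl⟩ : ∃ i, b₁ = b + 1 + i := ⟨b₁ - (b + 1), by omega⟩
    have hi : b + 1 + i - (b + 1) = i := by omega
    rw [hi]
    calc _ ≤ ∑ d ∈ D, (τ ^ i) ^ (k + 1) * (C₁ / 2 ^ b) ^ k / (a ^ i) ^ k * t b d := by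
          refine sum_le_sum fun d _ => ?_
          rw [mul_pow, pow_succ (t b d) k, div_mul_eq_mul_div]
          have := pow_le_pow_left₀ (ht b d) (h1 b hb.1 d) k
          have := ht b d
          rw [mul_assoc]
          gcongr
      _ ≤ (τ ^ i) ^ (k + 1) * (C₁ / 2 ^ b) ^ k / (a ^ i) ^ k * C₂ := by
          rw [← mul_sum]
          have := h2 b
          gcongr
      _ = _ := by
          have e1 : (τ ^ i) ^ (k + 1) * (2 ^ i) ^ k = a ^ i * (a ^ i) ^ k := by
            rw [← pow_succ', ← pow_mul, mul_comm i, pow_mul, ← pow_mul 2, mul_comm i k, pow_mul 2,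
              ← mul_pow, ← hak, ← pow_mul, ← pow_mul, mul_comm]
          have e2 : C₁ / 2 ^ b = 2 ^ i * (2 * C₁ / 2 ^ (b + 1 + i)) := by
            rw [pow_add, pow_succ]; field_simp
          rw [e2, mul_pow (2 ^ i), ← mul_assoc, e1]
          field_simp
  calc _ ≤ ∑ d ∈ D, (∑ b ∈ Ico b₀ b₁, a ^ (b₁ - (b + 1))) ^ k *
        ∑ b ∈ Ico b₀ b₁, (τ ^ (b₁ - (b + 1)) * t b d) ^ (k + 1) / (a ^ (b₁ - (b + 1))) ^ k :=
        sum_le_sum fun d _ => sum_pow_succ_le_weighted _ (fun b _ => by positivity)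
          (fun b _ => mul_nonneg (by positivity) (ht b d)) k
    _ = (∑ b ∈ Ico b₀ b₁, a ^ (b₁ - (b + 1))) ^ k * ∑ b ∈ Ico b₀ b₁, ∑ d ∈ D,
        (τ ^ (b₁ - (b + 1)) * t b d) ^ (k + 1) / (a ^ (b₁ - (b + 1))) ^ k := by
        rw [← mul_sum, sum_comm]
    _ ≤ (∑ b ∈ Ico b₀ b₁, a ^ (b₁ - (b + 1))) ^ k * ∑ b ∈ Ico b₀ b₁,
        a ^ (b₁ - (b + 1)) * ((2 * C₁ / 2 ^ b₁) ^ k * C₂) := by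
        gcongr with b hb
        exact hone b hb
    _ = (∑ b ∈ Ico b₀ b₁, a ^ (b₁ - (b + 1))) ^ (k + 1) * ((2 * C₁ / 2 ^ b₁) ^ k * C₂) := by
        rw [← sum_mul]; ring
    _ ≤ _ := by gcongr

/-! ### Well spread random sets -/

open Classical in
/-- The `L ^ (k + 1)` norm of the law of the difference of two random subset sums, truncated to
well spread sets, is of the order which a uniform law on `2 ^ b₁` points would give. -/
lemma sum_bernExp_wellSpread_pow_le {α : ℝ} (hα : 0 ≤ α) {k : ℕ} {K τ a : ℝ} (hK : 0 ≤ K)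
    (hτ : 0 ≤ τ) (ha0 : 0 < a) (ha1 : a < 1) (hak : a ^ (k + 1) = τ ^ (k + 1) * 2 ^ k)
    {b₀ b₁ : ℕ} (hb : b₀ ≤ b₁) (hb₁ : (a ^ (k + 1)) ^ (b₁ - b₀) * (2 ^ b₀) ^ k ≤ 1)
    (D : Finset ℤ) :
    ∑ d ∈ D, (bernExp (hitProb α) (Ioc (2 ^ b₀) (2 ^ b₁))
      (fun A => if WellSpread K τ b₀ b₁ A then subsetDiffProb A d else 0)) ^ (k + 1) ≤
    2 ^ k * K ^ (k + 1) *
      (1 + (1 / (1 - a)) ^ (k + 1) * ((α * Real.exp α) ^ k * (α / 2))) / (2 ^ b₁) ^ k := by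
  set y : ℤ → ℝ := fun d => ∑ b ∈ Ico b₀ b₁, τ ^ (b₁ - (b + 1)) * blockTerm α b₀ b d with hy
  have hy0 : ∀ d, 0 ≤ y d := fun d =>
    sum_nonneg fun b _ => mul_nonneg (by positivity) (blockTerm_nonneg hα _ _ _)
  have hpt : ∀ d ∈ D, (bernExp (hitProb α) (Ioc (2 ^ b₀) (2 ^ b₁))
      (fun A => if WellSpread K τ b₀ b₁ A then subsetDiffProb A d else 0)) ^ (k + 1) ≤
      2 ^ k * K ^ (k + 1) * ((if d = 0 then (τ ^ (b₁ - b₀)) ^ (k + 1) else 0) +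
        y d ^ (k + 1)) := by
    intro d _
    have h1 := bernExp_wellSpread_subsetDiffProb_le hα hK hτ hb d
    have h0 : 0 ≤ bernExp (hitProb α) (Ioc (2 ^ b₀) (2 ^ b₁))
        (fun A => if WellSpread K τ b₀ b₁ A then subsetDiffProb A d else 0) :=
      bernExp_nonneg (hitProb_nonneg hα) (hitProb_le_one α) fun A _ => by
        split_ifs
        · exact subsetDiffProb_nonneg _ _
        · exact le_rfl
    refine (pow_le_pow_left₀ h0 h1 _).trans ?_
    refine (add_pow_le (by positivity) (mul_nonneg hK (hy0 d)) (k + 1)).trans_eq ?_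
    rw [Nat.add_sub_cancel]
    split_ifs
    · ring
    · simp; ring
  refine (sum_le_sum hpt).trans ?_
  rw [← mul_sum, sum_add_distrib, mul_div_assoc]
  refine mul_le_mul_of_nonneg_left ?_ (by positivity)
  rw [add_div]
  refine add_le_add ?_ ?_
  · calc ∑ d ∈ D, (if d = 0 then (τ ^ (b₁ - b₀)) ^ (k + 1) else 0)
        ≤ (τ ^ (b₁ - b₀)) ^ (k + 1) := by
          rw [sum_ite_eq']
          split_ifs
          · exact le_rfl
          · positivity
      _ ≤ 1 / (2 ^ b₁) ^ k := by
          rw [le_div_iff₀ (by positivity)]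
          refine le_trans (le_of_eq ?_) hb₁
          rw [hak, mul_pow]
          obtain ⟨i, rfl⟩ : ∃ i, b₁ = b₀ + i := ⟨b₁ - b₀, by omega⟩
          rw [Nat.add_sub_cancel_left]
          ring
  · refine (sum_pow_sum_scales_le hτ ha0 ha1 (C₁ := α * Real.exp α / 2) (by positivity) hak D
      (b₀ := b₀) (b₁ := b₁) (blockTerm α b₀) (blockTerm_nonneg hα b₀)
      (fun b hb d => blockTerm_le hα hb d)
      (fun b => sum_blockTerm_le hα b₀ b D)).trans_eq ?_
    rw [mul_div_cancel₀ _ (two_ne_zero), div_pow]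
    ring

lemma log_div_le_sum_Ioc_inv {Y Z : ℕ} (h : Y ≤ Z) :
    Real.log ((Z + 1) / (Y + 1)) ≤ ∑ j ∈ Ioc Y Z, (1 / j : ℝ) := by
  induction Z, h using Nat.le_induction with
  | base => rw [div_self (by positivity)]; simp
  | succ Z hZ ih =>
    rw [sum_Ioc_succ_top (by omega)]
    have h1 : (((Z + 1 : ℕ) : ℝ) + 1) / (Y + 1) =
        ((Z + 1) / (Y + 1)) * (1 + 1 / ((Z : ℝ) + 1)) := by push_cast; field_simp
    rw [h1, Real.log_mul (by positivity) (by positivity)]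
    have h2 := Real.log_le_sub_one_of_pos (x := 1 + 1 / ((Z : ℝ) + 1)) (by positivity)
    push_cast
    linarith

/-- The mean number of elements hit in a dyadic block tends to `α log 2`. -/
lemma exists_forall_le_sum_hitProb {α l : ℝ} (hα : 0 < α) (hl : l < α * Real.log 2) :
    ∃ b', ∀ b, b' ≤ b → l ≤ ∑ j ∈ Ioc (2 ^ b) (2 ^ (b + 1)), hitProb α j := by
  have hbound : ∀ b : ℕ, α / (1 + α / (2 : ℝ) ^ b) * Real.log (2 - 1 / ((2 : ℝ) ^ b + 1)) ≤
      ∑ j ∈ Ioc (2 ^ b) (2 ^ (b + 1)), hitProb α j := by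
    intro b
    have h1 := log_div_le_sum_Ioc_inv (Y := 2 ^ b) (Z := 2 ^ (b + 1))
      (Nat.pow_le_pow_right two_pos (Nat.le_succ b))
    have h2 : (((2 ^ (b + 1) : ℕ) : ℝ) + 1) / (((2 ^ b : ℕ) : ℝ) + 1) =
        2 - 1 / ((2 : ℝ) ^ b + 1) := by push_cast; rw [pow_succ]; field_simp; ring
    rw [h2] at h1
    refine (mul_le_mul_of_nonneg_left h1 (by positivity)).trans ?_
    rw [mul_sum]
    refine sum_le_sum fun j hj => ?_
    rw [mem_Ioc] at hj
    have hj1 : (2 : ℝ) ^ b ≤ j := by exact_mod_cast hj.1.le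
    have hj0 : (0 : ℝ) < j := lt_of_lt_of_le (by positivity) hj1
    have h3 := div_one_add_div_le_hitProb hα.le j
    refine le_trans ?_ h3
    calc α / (1 + α / (2 : ℝ) ^ b) * (1 / j) = α / j / (1 + α / 2 ^ b) := by ring
      _ ≤ _ := by gcongr
  have hlim : Filter.Tendsto (fun b : ℕ => α / (1 + α / (2 : ℝ) ^ b) *
      Real.log (2 - 1 / ((2 : ℝ) ^ b + 1))) Filter.atTop (nhds (α * Real.log 2)) := by
    have hp : Filter.Tendsto (fun b : ℕ => (2 : ℝ) ^ b) Filter.atTop Filter.atTop :=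
      tendsto_pow_atTop_atTop_of_one_lt one_lt_two
    have h1 : Filter.Tendsto (fun b : ℕ => α / (2 : ℝ) ^ b) Filter.atTop (nhds 0) :=
      hp.const_div_atTop α
    have h2 : Filter.Tendsto (fun b : ℕ => 1 / ((2 : ℝ) ^ b + 1)) Filter.atTop (nhds 0) :=
      (Filter.tendsto_atTop_add_const_right _ 1 hp).const_div_atTop 1
    have h3 : Filter.Tendsto (fun b : ℕ => α / (1 + α / (2 : ℝ) ^ b)) Filter.atTop
        (nhds (α / (1 + 0))) := tendsto_const_nhds.div (h1.const_add 1) (by norm_num)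
    have h4 : Filter.Tendsto (fun b : ℕ => Real.log (2 - 1 / ((2 : ℝ) ^ b + 1))) Filter.atTop
        (nhds (Real.log (2 - 0))) := (h2.const_sub 2).log (by norm_num)
    simpa using h3.mul h4
  obtain ⟨b', hb'⟩ := Filter.eventually_atTop.1 (hlim.eventually (lt_mem_nhds hl))
  exact ⟨b', fun b hb => (hb' b hb).le.trans (hbound b)⟩

/-- The Laplace transform of the number of elements hit above `2 ^ b`. -/
lemma bernExp_pow_card_filter_le {α θ l : ℝ} (hθ0 : 0 ≤ θ) (hθ1 : θ ≤ 1)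
    {b₀ b b₁ : ℕ} (h0 : b₀ ≤ b) (h1 : b ≤ b₁)
    (hl : ∀ c, b ≤ c → l ≤ ∑ j ∈ Ioc (2 ^ c) (2 ^ (c + 1)), hitProb α j) :
    bernExp (hitProb α) (Ioc (2 ^ b₀) (2 ^ b₁)) (fun A => θ ^ #(A.filter (2 ^ b < ·))) ≤
      Real.exp (-((1 - θ) * l)) ^ (b₁ - b) := by
  have hprod : ∀ A : Finset ℕ, θ ^ #(A.filter (2 ^ b < ·)) =
      ∏ j ∈ A, if 2 ^ b < j then θ else 1 := by
    intro A
    rw [prod_ite]; simp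
  simp only [hprod]
  rw [bernExp_prod]
  have hfac : ∀ j, hitProb α j * (if 2 ^ b < j then θ else 1) + (1 - hitProb α j) =
      if 2 ^ b < j then 1 - (1 - θ) * hitProb α j else 1 := by
    intro j; split_ifs <;> ring
  simp only [hfac]
  rw [← prod_filter]
  have hf : (Ioc (2 ^ b₀) (2 ^ b₁)).filter (2 ^ b < ·) = Ioc (2 ^ b) (2 ^ b₁) := by
    have := Nat.pow_le_pow_right two_pos h0
    ext x; simp only [mem_filter, mem_Ioc]; omega
  rw [hf]
  calc ∏ j ∈ Ioc (2 ^ b) (2 ^ b₁), (1 - (1 - θ) * hitProb α j)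
      ≤ ∏ j ∈ Ioc (2 ^ b) (2 ^ b₁), Real.exp (-((1 - θ) * hitProb α j)) := by
        refine prod_le_prod (fun j _ => ?_) fun j _ => Real.one_sub_le_exp_neg _
        have := hitProb_le_one α j
        nlinarith
    _ = Real.exp (-((1 - θ) * ∑ b ∈ Ico b b₁, ∑ j ∈ Ioc (2 ^ b) (2 ^ (b + 1)), hitProb α j)) := by
        rw [← Real.exp_sum, sum_neg_distrib, ← mul_sum, sum_Ioc_two_pow h1]
    _ ≤ Real.exp (-((1 - θ) * ∑ b ∈ Ico b b₁, l)) := by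
        have : 0 ≤ 1 - θ := sub_nonneg.2 hθ1
        gcongr with c hc
        exact hl c (mem_Ico.1 hc).1
    _ = _ := by
        rw [← Real.exp_nat_mul, sum_const, Nat.card_Ico, nsmul_eq_mul]
        congr 1; ring

open Classical in
/-- With probability at least `3 / 4` the random set is well spread, with constants that do not
depend on the window. The events excluded are controlled by Markov's inequality. -/
lemma exists_bernExp_not_wellSpread_le {α θ υ l : ℝ} (hα : 0 ≤ α) {N : ℕ} (hθ0 : 0 ≤ θ)
    (hθ1 : θ ≤ 1) (hθN : θ ^ N = 1 / 2) (hυ : Real.exp (-((1 - θ) * l)) < υ) {b' : ℕ}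
    (hl : ∀ c, b' ≤ c → l ≤ ∑ j ∈ Ioc (2 ^ c) (2 ^ (c + 1)), hitProb α j) :
    ∃ K : ℝ, 0 ≤ K ∧ ∀ b₀ b₁, b' ≤ b₀ → b₀ ≤ b₁ →
      bernExp (hitProb α) (Ioc (2 ^ b₀) (2 ^ b₁))
        (fun A => if WellSpread K (υ ^ N) b₀ b₁ A then 0 else 1) ≤ 1 / 4 := by
  set ρ := Real.exp (-((1 - θ) * l)) with hρ
  have hρ0 : 0 < ρ := Real.exp_pos _
  have hυ0 : 0 < υ := hρ0.trans hυ
  set r := ρ / υ with hr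
  have hr0 : 0 ≤ r := by positivity
  have hr1 : r < 1 := (div_lt_one hυ0).2 hυ
  set K := 4 / (1 - r) with hKdef
  have hK : 0 < K := div_pos four_pos (sub_pos.2 hr1)
  refine ⟨K ^ N, by positivity, fun b₀ b₁ hb' hb => ?_⟩
  have hpt : ∀ A, A ⊆ Ioc (2 ^ b₀) (2 ^ b₁) →
      (if WellSpread (K ^ N) (υ ^ N) b₀ b₁ A then (0 : ℝ) else 1) ≤
        ∑ b ∈ Icc b₀ b₁, 1 / (K * υ ^ (b₁ - b)) * θ ^ #(A.filter (2 ^ b < ·)) := by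
    intro A _
    split_ifs with hW
    · exact sum_nonneg fun b _ => by positivity
    · simp only [WellSpread, not_forall, not_le] at hW
      obtain ⟨b, hb, hlt⟩ := hW
      have h1 : K * υ ^ (b₁ - b) ≤ θ ^ #(A.filter (2 ^ b < ·)) := by
        refine le_of_lt (lt_of_pow_lt_pow_left₀ N (by positivity) ?_)
        rwa [mul_pow, pow_right_comm υ, pow_right_comm θ, hθN]
      calc (1 : ℝ) ≤ 1 / (K * υ ^ (b₁ - b)) * θ ^ #(A.filter (2 ^ b < ·)) := by
            rw [one_div_mul_eq_div, le_div_iff₀ (by positivity), one_mul]; exact h1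
        _ ≤ _ := single_le_sum
            (f := fun b => 1 / (K * υ ^ (b₁ - b)) * θ ^ #(A.filter (2 ^ b < ·)))
            (fun b _ => by positivity) hb
  refine (bernExp_mono (hitProb_nonneg hα) (hitProb_le_one α) hpt).trans ?_
  rw [bernExp_sum]
  calc _ ≤ ∑ b ∈ Icc b₀ b₁, 1 / K * r ^ (b₁ - b) := by
        refine sum_le_sum fun b hb => ?_
        rw [mem_Icc] at hb
        rw [bernExp_mul]
        refine (mul_le_mul_of_nonneg_left (bernExp_pow_card_filter_le hθ0 hθ1 hb.1 hb.2
          fun c hc => hl c (by omega)) (by positivity)).trans_eq ?_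
        rw [hr, div_pow, ← hρ]
        field_simp
    _ ≤ 1 / K * (1 / (1 - r)) := by
        rw [← mul_sum]
        gcongr
        calc ∑ b ∈ Icc b₀ b₁, r ^ (b₁ - b) ≤ ∑ b ∈ range (b₁ + 1), r ^ (b₁ - b) := by
              refine sum_le_sum_of_subset_of_nonneg (fun x hx => ?_) fun _ _ _ => by positivity
              simp only [mem_Icc, mem_range] at *; omega
          _ = ∑ i ∈ range (b₁ + 1), r ^ i := by
              rw [← sum_range_reflect]
              refine sum_congr rfl fun i hi => ?_
              rw [mem_range] at hi
              congr 1; omega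
          _ ≤ 1 / (1 - r) := by
              rw [one_div, ← tsum_geometric_of_lt_one hr0 hr1]
              exact (summable_geometric_of_lt_one hr0 hr1).sum_le_tsum _
                fun _ _ => by positivity
    _ = 1 / 4 := by
        have : 1 - r ≠ 0 := (sub_pos.2 hr1).ne'
        rw [hKdef]; field_simp

/-- The choice of constants: with `θ = 2 ^ (-1 / N)`, where `N` is large, a Poisson count whose mean
per dyadic block is `l` makes the truncated second moment converge. -/
lemma exists_scale_parameters {k : ℕ} {l : ℝ} (hl : (k : ℝ) < (k + 1) * l) :
    ∃ (N : ℕ) (θ υ a : ℝ), 0 ≤ θ ∧ θ ≤ 1 ∧ θ ^ N = 1 / 2 ∧ Real.exp (-((1 - θ) * l)) < υ ∧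
      0 < a ∧ a < 1 ∧ a ^ (k + 1) = (υ ^ N) ^ (k + 1) * 2 ^ k := by
  have hl0 : 0 < l := by
    by_contra! h
    have : (0 : ℝ) ≤ k := k.cast_nonneg
    nlinarith
  have hlog : 0 < Real.log 2 := Real.log_pos one_lt_two
  have hlim : Filter.Tendsto (fun N : ℕ => (k + 1) * l / (1 + Real.log 2 / N)) Filter.atTop
      (nhds ((k + 1) * l / (1 + 0))) :=
    tendsto_const_nhds.div ((tendsto_const_div_atTop_nhds_zero_nat (Real.log 2)).const_add 1)
      (by norm_num)
  rw [add_zero, div_one] at hlim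
  obtain ⟨N, hN, hN1⟩ := ((hlim.eventually (lt_mem_nhds hl)).and
    (Filter.eventually_ge_atTop 1)).exists
  have hN0 : (0 : ℝ) < N := by exact_mod_cast hN1
  set x := Real.log 2 / N with hx
  have hx0 : 0 < x := div_pos hlog hN0
  set θ := Real.exp (-x) with hθ
  have hθ1 : x / (1 + x) ≤ 1 - θ := by
    have h4 : θ ≤ 1 / (1 + x) := by
      rw [hθ, Real.exp_neg, ← one_div]
      have := Real.add_one_le_exp x
      exact one_div_le_one_div_of_le (by positivity) (by linarith)
    have h5 : x / (1 + x) = 1 - 1 / (1 + x) := by field_simp; ring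
    linarith
  have hθN : θ ^ N = 1 / 2 := by
    rw [hθ, ← Real.exp_nat_mul, hx, mul_neg, mul_div_cancel₀ _ hN0.ne', Real.exp_neg,
      Real.exp_log two_pos, one_div]
  -- At `υ = exp (-(1 - θ) l)` the last condition holds with strict inequality, hence also nearby.
  have hstrict : (Real.exp (-((1 - θ) * l)) ^ N) ^ (k + 1) * 2 ^ k < 1 := by
    have h2 : (2 : ℝ) ^ k = Real.exp (k * Real.log 2) := by
      rw [Real.exp_nat_mul, Real.exp_log two_pos]
    rw [h2, ← Real.exp_nat_mul, ← Real.exp_nat_mul, ← Real.exp_add, Real.exp_lt_one_iff]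
    have h3 : N * (x / (1 + x)) * l ≤ N * (1 - θ) * l := by gcongr
    have h4 : N * (x / (1 + x)) = Real.log 2 / (1 + x) := by
      rw [mul_div_assoc', hx, mul_div_cancel₀ _ hN0.ne']
    have h5 : k * Real.log 2 < (k + 1) * (Real.log 2 / (1 + x) * l) := by
      calc _ < (k + 1) * l / (1 + x) * Real.log 2 := by gcongr
        _ = _ := by ring
    have h6 : ((k : ℝ) + 1) * (Real.log 2 / (1 + x) * l) ≤ (k + 1) * (N * (1 - θ) * l) := by
      rw [← h4]; gcongr
    push_cast
    nlinarith
  have hcont : Filter.Tendsto (fun υ : ℝ => (υ ^ N) ^ (k + 1) * 2 ^ k)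
      (nhdsWithin (Real.exp (-((1 - θ) * l))) (Set.Ioi (Real.exp (-((1 - θ) * l)))))
      (nhds ((Real.exp (-((1 - θ) * l)) ^ N) ^ (k + 1) * 2 ^ k)) :=
    (Continuous.tendsto (by fun_prop) _).mono_left nhdsWithin_le_nhds
  obtain ⟨υ, hυ1, hυ2⟩ := ((hcont.eventually (gt_mem_nhds hstrict)).and
    self_mem_nhdsWithin).exists
  have hυ0 : 0 < υ := (Real.exp_pos _).trans hυ2
  have hpos : 0 < (υ ^ N) ^ (k + 1) * 2 ^ k := by positivity
  refine ⟨N, θ, υ, ((υ ^ N) ^ (k + 1) * 2 ^ k) ^ (((k + 1 : ℕ) : ℝ)⁻¹), (Real.exp_pos _).le,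
    Real.exp_le_one_iff.2 (by linarith), hθN, hυ2, Real.rpow_pos_of_pos hpos _,
    Real.rpow_lt_one hpos.le hυ1 (by positivity), Real.rpow_inv_natCast_pow hpos.le (by omega)⟩

/-! ### The second moment method -/

open Classical in
/-- The second moment method for the number of `n ∈ R` at which `m` independent copies of `Q` are
simultaneously nonzero. -/
lemma sq_sum_pow_le_second_moment {β ι : Type*} (P : Finset β) {w : β → ℝ}
    (hw : ∀ A, 0 ≤ w A) (Q : β → ι → ℝ) (R : Finset ι) (m : ℕ) :
    (∑ n ∈ R, (∑ A ∈ P, w A * Q A n) ^ m) ^ 2 ≤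
      (∑ A ∈ Fintype.piFinset (fun _ : Fin m => P), (∏ i, w (A i)) *
        (if ∃ n ∈ R, ∀ i, Q (A i) n ≠ 0 then 1 else 0)) *
      ∑ n ∈ R, ∑ n' ∈ R, (∑ A ∈ P, w A * (Q A n * Q A n')) ^ m := by
  set Z : (Fin m → β) → ℝ := fun A => ∑ n ∈ R, ∏ i, Q (A i) n with hZ
  have h1 : ∑ n ∈ R, (∑ A ∈ P, w A * Q A n) ^ m =
      ∑ A ∈ Fintype.piFinset (fun _ : Fin m => P), (∏ i, w (A i)) * Z A := by
    simp only [hZ, mul_sum]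
    rw [sum_comm]
    refine sum_congr rfl fun n _ => ?_
    rw [sum_pow']
    simp only [prod_mul_distrib]
  have h2 : ∑ n ∈ R, ∑ n' ∈ R, (∑ A ∈ P, w A * (Q A n * Q A n')) ^ m =
      ∑ A ∈ Fintype.piFinset (fun _ : Fin m => P), (∏ i, w (A i)) * Z A ^ 2 := by
    simp only [hZ, sq, sum_mul_sum]
    simp only [mul_sum]
    conv_rhs => rw [sum_comm]
    refine sum_congr rfl fun n _ => ?_
    conv_rhs => rw [sum_comm]
    refine sum_congr rfl fun n' _ => ?_
    rw [sum_pow']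
    simp only [prod_mul_distrib]
  rw [h1, h2]
  have hw' : ∀ A : Fin m → β, 0 ≤ ∏ i, w (A i) := fun A => prod_nonneg fun i _ => hw _
  refine sum_sq_le_sum_mul_sum_of_sq_le_mul _ (fun A _ => ?_) (fun A _ => ?_) fun A _ => ?_
  · exact mul_nonneg (hw' A) (by split_ifs <;> norm_num)
  · exact mul_nonneg (hw' A) (sq_nonneg _)
  · refine le_of_eq ?_
    split_ifs with h
    · ring
    · push Not at h
      have : Z A = 0 := sum_eq_zero fun n hn => by
        obtain ⟨i, hi⟩ := h n hn
        exact prod_eq_zero (mem_univ i) hi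
      rw [this]; ring

/-- Some nonzero number is a subset sum of each of the sets `A i`. -/
def HasCommonSum {m : ℕ} (A : Fin m → Finset ℕ) : Prop :=
  ∃ n : ℕ, 0 < n ∧ ∀ i, ∃ S ⊆ A i, ∑ j ∈ S, j = n

lemma bernExp_sum_inter_eq_singleton (p : ℕ → ℝ) {I J : Finset ℕ} (hd : Disjoint I J)
    (Φ : ℕ → Finset ℕ → ℝ) :
    bernExp p (I ∪ J) (fun A => ∑ u ∈ J, if A ∩ J = {u} then Φ u (A ∩ I) else 0) =
      ∑ u ∈ J, bernWeight p J {u} * bernExp p I (Φ u) := by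
  rw [bernExp_union p hd]
  have h : ∀ A, A ⊆ I → bernExp p J (fun B => ∑ u ∈ J,
      if (A ∪ B) ∩ J = {u} then Φ u ((A ∪ B) ∩ I) else 0) =
      ∑ u ∈ J, bernWeight p J {u} * Φ u A := by
    intro A hA
    have hB : ∀ B, B ⊆ J → (∑ u ∈ J, if (A ∪ B) ∩ J = {u} then Φ u ((A ∪ B) ∩ I) else 0) =
        ∑ u ∈ J, if B = {u} then Φ u A else 0 := by
      intro B hB
      have e1 : (A ∪ B) ∩ J = B := by
        rw [union_inter_distrib_right, inter_eq_left.2 hB,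
          disjoint_iff_inter_eq_empty.1 (hd.mono_left hA), empty_union]
      have e2 : (A ∪ B) ∩ I = A := by
        rw [union_inter_distrib_right, inter_eq_left.2 hA,
          disjoint_iff_inter_eq_empty.1 (hd.symm.mono_left hB), union_empty]
      rw [e1, e2]
    rw [bernExp_congr hB, bernExp_sum]
    refine sum_congr rfl fun u hu => ?_
    rw [bernExp, sum_eq_single {u}, if_pos rfl]
    · intro B _ hne
      rw [if_neg hne, mul_zero]
    · exact fun h => absurd (mem_powerset.2 (singleton_subset_iff.2 hu)) h
  rw [bernExp_congr h, bernExp_sum]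
  exact sum_congr rfl fun u _ => bernExp_mul _ _ _ _

lemma sum_ite_inter_eq_singleton_mul (A J : Finset ℕ) (f g : ℕ → ℝ) :
    (∑ u ∈ J, if A ∩ J = {u} then f u else 0) * (∑ u ∈ J, if A ∩ J = {u} then g u else 0) =
      ∑ u ∈ J, if A ∩ J = {u} then f u * g u else 0 := by
  by_cases h : ∃ u, A ∩ J = {u}
  · obtain ⟨v, hv⟩ := h
    have hvJ : v ∈ J := mem_of_mem_inter_right (hv ▸ mem_singleton_self v : v ∈ A ∩ J)
    simp only [hv, singleton_inj, sum_ite_eq, hvJ, if_true]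
  · push Not at h
    simp [h]

lemma bernWeight_singleton_le {α : ℝ} (hα : 0 ≤ α) (J : Finset ℕ) (u : ℕ) :
    bernWeight (hitProb α) J {u} ≤ α / u := by
  rw [bernWeight, prod_singleton]
  have h1 : ∏ j ∈ J \ {u}, (1 - hitProb α j) ≤ 1 :=
    prod_le_one (fun j _ => sub_nonneg.2 (hitProb_le_one α j))
      fun j _ => by linarith [hitProb_nonneg hα j]
  calc _ ≤ hitProb α u * 1 := mul_le_mul_of_nonneg_left h1 (hitProb_nonneg hα u)
    _ ≤ _ := by rw [mul_one]; exact hitProb_le_div α u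

lemma le_bernWeight_singleton {α : ℝ} (hα : 0 < α) {H u : ℕ} (hH : α ≤ H)
    (hu : u ∈ Ioc (2 * H) (4 * H)) :
    Real.exp (-α) * (α / 5) / H ≤ bernWeight (hitProb α) (Ioc (2 * H) (4 * H)) {u} := by
  have hH0 : (0 : ℝ) < H := hα.trans_le hH
  have hHn : 0 < H := by exact_mod_cast hH0
  rw [mem_Ioc] at hu
  have hu0 : (0 : ℝ) < u := by exact_mod_cast (by omega : 0 < u)
  have hu4 : (u : ℝ) ≤ 4 * H := by exact_mod_cast hu.2
  rw [bernWeight, prod_singleton]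
  have h1 := exp_neg_le_prod_one_sub_hitProb hα.le (J := Ioc (2 * H) (4 * H) \ {u})
    (Y := 2 * H) (by omega) (fun j hj => by simp only [mem_sdiff, mem_Ioc] at hj; omega)
    ((card_le_card sdiff_subset).trans (by rw [Nat.card_Ioc]; omega))
  have h2 : α / 5 / H ≤ hitProb α u := by
    refine le_trans ?_ (div_one_add_div_le_hitProb hα.le u)
    have : α / u / (1 + α / u) = α / (u + α) := by field_simp
    rw [this, div_div]
    gcongr
    linarith
  calc Real.exp (-α) * (α / 5) / H = α / 5 / H * Real.exp (-α) := by ring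
    _ ≤ _ := mul_le_mul h2 h1 (Real.exp_pos _).le (hitProb_nonneg hα.le u)

/-! ### Windows with a common subset sum -/

open Classical in
/-- Beyond any `N` there is a window in which, with probability at least `c`, the random sets of
`k + 1` independent copies have a common nonzero subset sum; `c` does not depend on `N`.

Below `2 ^ b₁` the random sets provide the many subset sums. A single element `u` in
`(2 H, 4 H]`, where `H` is of the order of `2 ^ b₁`, spreads them evenly over `(3 H, 4 H]`. -/
lemma exists_window {α : ℝ} (hα : 0 < α) {k : ℕ} (h : (k : ℝ) < (k + 1) * (α * Real.log 2)) :
    ∃ c : ℝ, 0 < c ∧ ∀ N : ℕ, ∃ W : Finset ℕ, (∀ j ∈ W, N < j) ∧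
      c ≤ ∑ A ∈ Fintype.piFinset (fun _ : Fin (k + 1) => W.powerset),
        (∏ i, bernWeight (hitProb α) W (A i)) * (if HasCommonSum A then 1 else 0) := by
  set p := hitProb α with hp
  have hp0 := hitProb_nonneg hα.le
  have hp1 := hitProb_le_one α
  obtain ⟨l, hkl, hlα⟩ : ∃ l : ℝ, (k : ℝ) < (k + 1) * l ∧ l < α * Real.log 2 := by
    have hk : (0 : ℝ) < k + 1 := by positivity
    obtain ⟨l, h1, h2⟩ := exists_between ((div_lt_iff₀' hk).2 h)
    exact ⟨l, (div_lt_iff₀' hk).1 h1, h2⟩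
  obtain ⟨b', hb'⟩ := exists_forall_le_sum_hitProb hα hlα
  obtain ⟨N₀, θ, υ, a, hθ0, hθ1, hθN, hυ, ha0, ha1, hak⟩ := exists_scale_parameters hkl
  obtain ⟨K, hK, hWS⟩ := exists_bernExp_not_wellSpread_le hα.le hθ0 hθ1 hθN hυ hb'
  have hυ0 : 0 < υ := (Real.exp_pos _).trans hυ
  set τ := υ ^ N₀ with hτ
  have hτ0 : 0 ≤ τ := by positivity
  -- `H = c₀ * 2 ^ b₁` is at least four times the mean of the sum of the random set.
  set c₀ : ℕ := ⌈4 * α⌉₊ + 1 with hc₀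
  have hc₀α : 4 * α ≤ c₀ := (Nat.le_ceil _).trans (by rw [hc₀]; push_cast; linarith)
  set C : ℝ := 2 ^ k * K ^ (k + 1) *
      (1 + (1 / (1 - a)) ^ (k + 1) * ((α * Real.exp α) ^ k * (α / 2))) with hC
  have hC0 : 0 ≤ C := by
    have : 0 < 1 - a := sub_pos.2 ha1
    positivity
  set w₁ : ℝ := Real.exp (-α) * (α / 5) with hw₁
  have hw₁0 : 0 < w₁ := by positivity
  set U : ℝ := (α / 2) ^ (k + 1) * (C + 1) * c₀ ^ k with hU
  have hU0 : 0 < U := by positivity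
  refine ⟨((w₁ / 2) ^ (k + 1)) ^ 2 / U, by positivity, fun N => ?_⟩
  set b₀ := max b' N with hb₀
  -- For this `b₁`, two subsets rarely agree on the whole window.
  obtain ⟨i, hi⟩ : ∃ i : ℕ, (a ^ (k + 1)) ^ i < 1 / (2 ^ b₀) ^ k :=
    exists_pow_lt_of_lt_one (by positivity) (pow_lt_one₀ ha0.le ha1 (by omega))
  set b₁ := b₀ + i with hb₁
  have hb01 : b₀ ≤ b₁ := Nat.le_add_right _ _
  set M : ℕ := 2 ^ b₁ with hM
  have hM0 : 0 < M := by positivity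
  set H : ℕ := c₀ * M with hH
  have hMH : M ≤ H := Nat.le_mul_of_pos_left _ (by omega)
  have hH0 : 0 < H := hM0.trans_le hMH
  have hHr : (0 : ℝ) < H := by exact_mod_cast hH0
  have hHα : 4 * α * M ≤ H := by
    rw [hH]; push_cast; gcongr
  have hHα' : α ≤ H := by
    have : (1 : ℝ) ≤ M := by exact_mod_cast hM0
    nlinarith
  set I : Finset ℕ := Ioc (2 ^ b₀) M with hI
  set J : Finset ℕ := Ioc (2 * H) (4 * H) with hJ
  have hIJ : Disjoint I J := by
    rw [Finset.disjoint_left]; intro x; simp only [hI, hJ, mem_Ioc]; omega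
  set G : Finset ℕ → Prop := fun A => WellSpread K τ b₀ b₁ A ∧ ∑ j ∈ A, j < H with hG
  set Φ : ℤ → ℕ → Finset ℕ → ℝ := fun n u A => if G A then subsetSumProb A (n - u) else 0 with hΦ
  set Q : Finset ℕ → ℤ → ℝ := fun A n =>
    ∑ u ∈ J, if A ∩ J = {u} then Φ n u (A ∩ I) else 0 with hQ
  set R : Finset ℤ := Ioc (3 * (H : ℤ)) (4 * H) with hR
  have hRcard : #R = H := by rw [hR, Int.card_Ioc]; omega
  -- The sets excluded by `G` have probability at most `1 / 2`.
  have hPG : 1 / 2 ≤ bernExp p I (fun A => if G A then 1 else 0) := by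
    have h1 : bernExp p I (fun _ => 1) ≤ bernExp p I (fun A => ((if G A then 1 else 0) +
        (if WellSpread K τ b₀ b₁ A then 0 else 1)) + 1 / H * ∑ j ∈ A, (j : ℝ)) := by
      refine bernExp_mono hp0 hp1 fun A _ => ?_
      have hs : (0 : ℝ) ≤ 1 / H * ∑ j ∈ A, (j : ℝ) := by positivity
      by_cases hW : WellSpread K τ b₀ b₁ A
      · by_cases hS : ∑ j ∈ A, j < H
        · rw [if_pos ⟨hW, hS⟩, if_pos hW]; linarith
        · rw [if_neg fun hG => hS hG.2, if_pos hW]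
          have : (H : ℝ) ≤ ∑ j ∈ A, (j : ℝ) := by
            rw [← Nat.cast_sum]; exact Nat.cast_le.2 (not_lt.1 hS)
          rw [one_div_mul_eq_div, zero_add, zero_add, le_div_iff₀ hHr]
          linarith
      · rw [if_neg fun hG => hW hG.1, if_neg hW]; linarith
    rw [bernExp_const, bernExp_add, bernExp_add, bernExp_mul, bernExp_sum_mem] at h1
    have h2 := hWS b₀ b₁ (le_max_left _ _) hb01
    have h3 : ∑ j ∈ I, p j * j ≤ α * M := by
      calc ∑ j ∈ I, p j * j ≤ ∑ j ∈ I, α := by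
            refine sum_le_sum fun j hj => ?_
            rw [hI, mem_Ioc] at hj
            have : (0 : ℝ) < j := by exact_mod_cast (Nat.zero_le _).trans_lt hj.1
            calc p j * j ≤ α / j * j := by gcongr; exact hitProb_le_div α j
              _ = α := by field_simp
        _ = #I * α := by simp
        _ ≤ M * α := by
            gcongr
            rw [hI, Nat.card_Ioc]; exact Nat.sub_le _ _
        _ = _ := mul_comm _ _
    have h4 : 1 / (H : ℝ) * ∑ j ∈ I, p j * j ≤ 1 / 4 := by
      rw [one_div_mul_eq_div, div_le_iff₀ hHr]
      linarith
    linarith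
  -- The expectation of `Q · n` is of the order of `1 / H`.
  have hfirst : ∀ n ∈ R, w₁ / 2 / H ≤ bernExp p (I ∪ J) (fun A => Q A n) := by
    intro n hn
    rw [hR, mem_Ioc] at hn
    simp only [hQ]
    rw [bernExp_sum_inter_eq_singleton p hIJ (Φ n)]
    calc w₁ / 2 / H ≤ w₁ / H * bernExp p I (fun A => if G A then 1 else 0) := by
          rw [div_right_comm, div_eq_mul_one_div (w₁ / H)]
          gcongr
      _ = w₁ / H * ∑ u ∈ J, bernExp p I (Φ n u) := by
          rw [← bernExp_sum]
          congr 1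
          refine bernExp_congr fun A _ => ?_
          simp only [hΦ]
          by_cases hGA : G A
          · simp only [hGA, if_true]
            refine (sum_subsetSumProb_eq_one A J n fun S hS => ?_).symm
            have h1 : ∑ j ∈ S, (j : ℤ) < H := by
              rw [← Nat.cast_sum]
              exact Nat.cast_lt.2 ((sum_le_sum_of_subset hS).trans_lt hGA.2)
            have h2 : 0 ≤ ∑ j ∈ S, (j : ℤ) := sum_nonneg fun j _ => by positivity
            refine ⟨(n - ∑ j ∈ S, (j : ℤ)).toNat, ?_, by omega⟩
            rw [hJ, mem_Ioc]; omega
          · simp [hGA]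
      _ ≤ _ := by
          rw [mul_sum]
          refine sum_le_sum fun u hu => ?_
          gcongr
          · refine bernExp_nonneg hp0 hp1 fun A _ => ?_
            simp only [hΦ]
            split_ifs
            · exact subsetSumProb_nonneg _ _
            · exact le_rfl
          · exact le_bernWeight_singleton hα hHα' hu
  set g : ℤ → ℝ := fun d => bernExp p I
    (fun A => if WellSpread K τ b₀ b₁ A then subsetDiffProb A d else 0) with hg
  have hg0 : ∀ d, 0 ≤ g d := fun d => bernExp_nonneg hp0 hp1 fun A _ => by
    split_ifs
    · exact subsetDiffProb_nonneg _ _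
    · exact le_rfl
  have hΦ0 : ∀ n u A, 0 ≤ Φ n u A := fun n u A => by
    simp only [hΦ]
    split_ifs
    · exact subsetSumProb_nonneg _ _
    · exact le_rfl
  have hQ0 : ∀ A n, 0 ≤ Q A n := fun A n => sum_nonneg fun u _ => by
    split_ifs
    · exact hΦ0 _ _ _
    · exact le_rfl
  have hsecond : ∀ n n', bernExp p (I ∪ J) (fun A => Q A n * Q A n') ≤
      α / 2 / H * g (n' - n) := by
    intro n n'
    simp only [hQ, sum_ite_inter_eq_singleton_mul]
    rw [bernExp_sum_inter_eq_singleton p hIJ (fun u A => Φ n u A * Φ n' u A)]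
    calc _ ≤ ∑ u ∈ J, α / 2 / H * bernExp p I (fun A => Φ n u A * Φ n' u A) := by
          refine sum_le_sum fun u hu => ?_
          refine mul_le_mul_of_nonneg_right ?_ (bernExp_nonneg hp0 hp1 fun A _ =>
            mul_nonneg (hΦ0 _ _ _) (hΦ0 _ _ _))
          refine (bernWeight_singleton_le hα.le J u).trans ?_
          rw [hJ, mem_Ioc] at hu
          have : (2 : ℝ) * H ≤ u := by exact_mod_cast hu.1.le
          rw [div_div]
          gcongr
      _ = α / 2 / H * bernExp p I (fun A => ∑ u ∈ J, Φ n u A * Φ n' u A) := by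
          rw [bernExp_sum, mul_sum]
      _ ≤ _ := by
          refine mul_le_mul_of_nonneg_left (bernExp_mono hp0 hp1 fun A _ => ?_) (by positivity)
          simp only [hΦ]
          by_cases hGA : G A
          · simp only [hGA, if_true, hGA.1]
            exact sum_subsetSumProb_mul_le A J n n'
          · simp only [hGA, if_false, mul_zero, sum_const_zero]
            split_ifs
            · exact subsetDiffProb_nonneg _ _
            · exact le_rfl
  have hgsum : ∀ D : Finset ℤ, ∑ d ∈ D, g d ^ (k + 1) ≤ C / (M : ℝ) ^ k := by
    intro D
    have := sum_bernExp_wellSpread_pow_le hα.le hK hτ0 ha0 ha1 hak hb01 (by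
      rw [hb₁, Nat.add_sub_cancel_left]
      exact ((lt_div_iff₀ (by positivity)).1 hi).le) D
    rw [hM]; push_cast
    exact this
  have hPZ := sq_sum_pow_le_second_moment (I ∪ J).powerset
    (w := bernWeight p (I ∪ J)) (bernWeight_nonneg hp0 hp1 _) Q R (k + 1)
  set S := ∑ A ∈ Fintype.piFinset (fun _ : Fin (k + 1) => (I ∪ J).powerset),
    (∏ i, bernWeight p (I ∪ J) (A i)) * (if ∃ n ∈ R, ∀ i, Q (A i) n ≠ 0 then (1 : ℝ) else 0)
    with hS
  have hS0 : 0 ≤ S := sum_nonneg fun A _ => mul_nonneg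
    (prod_nonneg fun i _ => bernWeight_nonneg hp0 hp1 _ _) (by split_ifs <;> norm_num)
  have hL : (w₁ / 2) ^ (k + 1) / (H : ℝ) ^ k ≤
      ∑ n ∈ R, (∑ A ∈ (I ∪ J).powerset, bernWeight p (I ∪ J) A * Q A n) ^ (k + 1) := by
    calc (w₁ / 2) ^ (k + 1) / (H : ℝ) ^ k = ∑ n ∈ R, (w₁ / 2 / H) ^ (k + 1) := by
          rw [sum_const, hRcard, nsmul_eq_mul, div_pow (w₁ / 2) (H : ℝ), pow_succ (H : ℝ)]
          field_simp
      _ ≤ _ := sum_le_sum fun n hn => pow_le_pow_left₀ (by positivity) (hfirst n hn) _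
  have hU' : ∑ n ∈ R, ∑ n' ∈ R,
      (∑ A ∈ (I ∪ J).powerset, bernWeight p (I ∪ J) A * (Q A n * Q A n')) ^ (k + 1) ≤
      U / ((H : ℝ) ^ k) ^ 2 := by
    calc _ ≤ ∑ n ∈ R, ∑ n' ∈ R, (α / 2 / H) ^ (k + 1) * g (n' - n) ^ (k + 1) := by
          refine sum_le_sum fun n _ => sum_le_sum fun n' _ => ?_
          rw [← mul_pow]
          exact pow_le_pow_left₀ (bernExp_nonneg hp0 hp1 fun A _ =>
            mul_nonneg (hQ0 _ _) (hQ0 _ _)) (hsecond n n') _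
      _ ≤ ∑ n ∈ R, (α / 2 / H) ^ (k + 1) * (C / (M : ℝ) ^ k) := by
          refine sum_le_sum fun n _ => ?_
          rw [← mul_sum]
          refine mul_le_mul_of_nonneg_left ?_ (by positivity)
          have := hgsum (R.image (fun n' => n' - n))
          rwa [sum_image (fun x _ y _ hxy => by simpa using hxy)] at this
      _ ≤ ∑ n ∈ R, (α / 2 / H) ^ (k + 1) * ((C + 1) / (M : ℝ) ^ k) := by
          gcongr; linarith
      _ = _ := by
          have hHk : (H : ℝ) ^ k = c₀ ^ k * M ^ k := by rw [hH]; push_cast; rw [mul_pow]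
          have : (0 : ℝ) < M := by exact_mod_cast hM0
          rw [sum_const, hRcard, nsmul_eq_mul, hU, div_pow (α / 2) (H : ℝ), pow_succ (H : ℝ)]
          generalize (α / 2) ^ (k + 1) = x
          field_simp
          rw [hHk]
          ring
  refine ⟨I ∪ J, fun j hj => ?_, ?_⟩
  · have h1 : N < 2 ^ b₀ := (Nat.lt_two_pow_self).trans_le
      (Nat.pow_le_pow_right two_pos (le_max_right _ _))
    have h2 : 2 ^ b₀ ≤ M := Nat.pow_le_pow_right two_pos hb01
    rw [mem_union, hI, hJ, mem_Ioc, mem_Ioc] at hj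
    omega
  calc ((w₁ / 2) ^ (k + 1)) ^ 2 / U ≤ S := by
        rw [div_le_iff₀ hU0]
        have h1 : ((w₁ / 2) ^ (k + 1) / (H : ℝ) ^ k) ^ 2 ≤ S * (U / ((H : ℝ) ^ k) ^ 2) :=
          (pow_le_pow_left₀ (by positivity) hL 2).trans
            (hPZ.trans (mul_le_mul_of_nonneg_left hU' hS0))
        rw [div_pow, ← mul_div_assoc, div_le_div_iff_of_pos_right (by positivity)] at h1
        exact h1
    _ ≤ _ := by
        refine sum_le_sum fun A _ => mul_le_mul_of_nonneg_left ?_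
          (prod_nonneg fun i _ => bernWeight_nonneg hp0 hp1 _ _)
        by_cases hE : ∃ n ∈ R, ∀ i, Q (A i) n ≠ 0
        swap
        · rw [if_neg hE]; split_ifs <;> norm_num
        rw [if_pos hE, if_pos]
        obtain ⟨n, hn, hn'⟩ := hE
        rw [hR, mem_Ioc] at hn
        refine ⟨n.toNat, by omega, fun i => ?_⟩
        obtain ⟨u, hu, hne⟩ := exists_ne_zero_of_sum_ne_zero (hn' i)
        have hAu : A i ∩ J = {u} := by by_contra hcon; exact hne (if_neg hcon)
        rw [if_pos hAu] at hne
        simp only [hΦ] at hne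
        have hGA : G (A i ∩ I) := by by_contra hcon; exact hne (if_neg hcon)
        rw [if_pos hGA] at hne
        obtain ⟨T, hT, hTs⟩ := exists_subset_of_subsetSumProb_ne_zero hne
        have huT : u ∉ T := fun huT =>
          Finset.disjoint_left.1 hIJ (mem_of_mem_inter_right (hT huT)) hu
        refine ⟨insert u T, insert_subset ?_ (hT.trans inter_subset_left), ?_⟩
        · exact mem_of_mem_inter_left (hAu ▸ mem_singleton_self u : u ∈ A i ∩ J)
        · rw [sum_insert huT]
          zify
          rw [hTs]
          omega

/-! ### Common elements of the sumsets almost surely -/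

/-- The set of indices in `W` at which `X` does not vanish; `W` is meant to consist of positive
integers. -/
def trace (X : ℕ+ → ℕ) (W : Finset ℕ) : Finset ℕ := W.filter fun j => X j.toPNat' ≠ 0

lemma bernWeight_eq_prod_ite (p : ℕ → ℝ) {W A : Finset ℕ} (hA : A ⊆ W) :
    bernWeight p W A = ∏ j ∈ W, if j ∈ A then p j else 1 - p j := by
  rw [prod_ite, bernWeight, filter_mem_eq_inter, inter_eq_right.2 hA, sdiff_eq_filter]

lemma poissonMeasure_zero_set {α : ℝ} (hα : 0 ≤ α) (j : ℕ) :
    poissonMeasure (Real.toNNReal (α / j)) {0} = ENNReal.ofReal (1 - hitProb α j) := by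
  rw [poissonMeasure_singleton, Real.coe_toNNReal _ (by positivity), hitProb]
  simp

lemma poissonMeasure_zero_compl {α : ℝ} (hα : 0 ≤ α) (j : ℕ) :
    poissonMeasure (Real.toNNReal (α / j)) {0}ᶜ = ENNReal.ofReal (hitProb α j) := by
  rw [prob_compl_eq_one_sub (measurableSet_singleton 0), poissonMeasure_zero_set hα,
    ← ENNReal.ofReal_one, ← ENNReal.ofReal_sub _ (sub_nonneg.2 (hitProb_le_one α j)),
    sub_sub_cancel]

lemma poissonSeqLaw_trace_eq {α : ℝ} (hα : 0 ≤ α) {W A : Finset ℕ} (hW : ∀ j ∈ W, 0 < j)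
    (hA : A ⊆ W) :
    poissonSeqLaw α {X | trace X W = A} = ENNReal.ofReal (bernWeight (hitProb α) W A) := by
  set t : ℕ+ → Set ℕ := fun j => if (j : ℕ) ∈ A then {0}ᶜ else {0} with ht
  have hset : {X : ℕ+ → ℕ | trace X W = A} = Set.pi (W.image Nat.toPNat') t := by
    ext X
    simp only [Set.mem_ofPred_eq, Set.mem_pi, coe_image, Set.mem_image, mem_coe, trace,
      forall_exists_index, and_imp, forall_apply_eq_imp_iff₂, ht]
    constructor
    · intro h j hj
      have hj' : ((j.toPNat' : ℕ+) : ℕ) = j := by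
        simp [Nat.toPNat'_coe, hW j hj]
      rw [hj', ← h]
      by_cases hX : X j.toPNat' = 0 <;> simp [hX, hj]
    · intro h
      ext j
      rw [mem_filter]
      constructor
      · rintro ⟨hj, hX⟩
        by_contra hjA
        have := h j hj
        rw [Nat.toPNat'_coe, if_pos (hW j hj), if_neg hjA] at this
        exact hX this
      · intro hjA
        have := h j (hA hjA)
        rw [Nat.toPNat'_coe, if_pos (hW j (hA hjA)), if_pos hjA] at this
        exact ⟨hA hjA, this⟩
  have hinj : Set.InjOn Nat.toPNat' (W : Set ℕ) := by
    intro x hx y hy hxy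
    have := congrArg PNat.val hxy
    simpa [Nat.toPNat'_coe, hW x hx, hW y hy] using this
  rw [hset, poissonSeqLaw, Measure.infinitePi_pi _ (fun j _ => MeasurableSet.of_discrete),
    prod_image hinj, bernWeight_eq_prod_ite _ hA, ENNReal.ofReal_prod_of_nonneg]
  · refine prod_congr rfl fun j hj => ?_
    simp only [ht, Nat.toPNat'_coe, hW j hj, if_true]
    split_ifs
    · exact poissonMeasure_zero_compl hα j
    · exact poissonMeasure_zero_set hα j
  · intro j _
    split_ifs
    · exact hitProb_nonneg hα j
    · exact sub_nonneg.2 (hitProb_le_one α j)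

/-- Traces on disjoint windows are independent. -/
lemma poissonSeqLaw_forall_trace_eq {α : ℝ} (hα : 0 ≤ α) {κ : Type*} [Fintype κ]
    {W A : κ → Finset ℕ} (hW : ∀ k, ∀ j ∈ W k, 0 < j) (hA : ∀ k, A k ⊆ W k)
    (hd : Pairwise fun k k' => Disjoint (W k) (W k')) :
    poissonSeqLaw α {X | ∀ k, trace X (W k) = A k} =
      ENNReal.ofReal (∏ k, bernWeight (hitProb α) (W k) (A k)) := by
  classical
  have hAW : univ.biUnion A ⊆ univ.biUnion W := biUnion_mono fun k _ => hA k
  have hmem : ∀ k, ∀ j ∈ W k, (j ∈ univ.biUnion A ↔ j ∈ A k) := by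
    intro k j hj
    simp only [mem_biUnion, mem_univ, true_and]
    refine ⟨fun ⟨k', hk'⟩ => ?_, fun h => ⟨k, h⟩⟩
    by_cases hkk : k = k'
    · exact hkk ▸ hk'
    · exact absurd (hA k' hk') (Finset.disjoint_left.1 (hd hkk) hj)
  have hset : {X : ℕ+ → ℕ | ∀ k, trace X (W k) = A k} =
      {X | trace X (univ.biUnion W) = univ.biUnion A} := by
    ext X
    simp only [Set.mem_ofPred_eq, trace]
    constructor
    · intro h
      rw [filter_biUnion]
      exact biUnion_congr rfl fun k _ => h k
    · intro h k
      ext j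
      have := Finset.ext_iff.1 h j
      by_cases hj : j ∈ W k
      · rw [← hmem k j hj, ← this]
        simp only [mem_filter, mem_biUnion, mem_univ, true_and, hj]
        exact ⟨fun h => ⟨⟨k, hj⟩, h⟩, fun h => h.2⟩
      · simp only [mem_filter, hj, false_and, false_iff]
        exact fun h => hj (hA k h)
  rw [hset, poissonSeqLaw_trace_eq hα (fun j hj => by
      obtain ⟨k, _, hk⟩ := mem_biUnion.1 hj
      exact hW k j hk) hAW, bernWeight_eq_prod_ite _ hAW,
    prod_biUnion fun k _ k' _ hkk => hd hkk]
  congr 1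
  refine prod_congr rfl fun k _ => ?_
  rw [bernWeight_eq_prod_ite _ (hA k)]
  exact prod_congr rfl fun j hj => by simp only [hmem k j hj]

lemma sum_mem_sumset {X : ℕ+ → ℕ} {S : Finset ℕ+} (hS : ∀ j ∈ S, X j ≠ 0) :
    ∑ j ∈ S, (j : ℕ) ∈ sumset X := by
  refine ⟨Finsupp.onFinset S (fun j => if j ∈ S then 1 else 0) (by simp), fun j => ?_, ?_⟩
  · rw [Finsupp.onFinset_apply]
    split_ifs with h
    · exact Nat.one_le_iff_ne_zero.2 (hS j h)
    · exact Nat.zero_le _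
  · rw [Finsupp.onFinset_sum _ (by simp)]
    exact sum_congr rfl fun j hj => by simp [hj]

lemma iInter_sumset_ne_of_hasCommonSum {m : ℕ} {X : Fin m → ℕ+ → ℕ} {W : Finset ℕ}
    (hW : ∀ j ∈ W, 0 < j) (h : HasCommonSum fun i => trace (X i) W) :
    (⋂ i, sumset (X i)) ≠ {0} := by
  obtain ⟨n, hn, hS⟩ := h
  intro heq
  have : n ∈ ⋂ i, sumset (X i) := by
    rw [Set.mem_iInter]
    intro i
    obtain ⟨S, hST, rfl⟩ := hS i
    have hpos : ∀ j ∈ S, 0 < j := fun j hj => hW j (mem_filter.1 (hST hj)).1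
    have hinj : Set.InjOn Nat.toPNat' (S : Set ℕ) := by
      intro x hx y hy hxy
      have := congrArg PNat.val hxy
      simpa [Nat.toPNat'_coe, hpos x hx, hpos y hy] using this
    have := sum_mem_sumset (X := X i) (S := S.image Nat.toPNat') fun j hj => by
      obtain ⟨x, hx, rfl⟩ := mem_image.1 hj
      exact (mem_filter.1 (hST hx)).2
    rw [sum_image hinj] at this
    convert this using 1
    exact sum_congr rfl fun j hj => by simp [Nat.toPNat'_coe, hpos j hj]
  rw [heq] at this
  exact hn.ne' this

open Classical in
lemma sum_not_hasCommonSum {p : ℕ → ℝ} (W : Finset ℕ) (m : ℕ) :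
    ∑ A ∈ (Fintype.piFinset fun _ : Fin m => W.powerset).filter (fun A => ¬ HasCommonSum A),
      ∏ i, bernWeight p W (A i) =
    1 - ∑ A ∈ Fintype.piFinset (fun _ : Fin m => W.powerset),
        (∏ i, bernWeight p W (A i)) * (if HasCommonSum A then 1 else 0) := by
  have h1 : ∑ A ∈ Fintype.piFinset (fun _ : Fin m => W.powerset),
      ∏ i, bernWeight p W (A i) = 1 := by
    rw [← sum_pow']
    have := bernExp_const p W 1
    simp only [bernExp, mul_one] at this
    rw [this, one_pow]
  have h2 := sum_filter_add_sum_filter_not (Fintype.piFinset fun _ : Fin m => W.powerset)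
    (fun A => HasCommonSum A) (fun A => ∏ i, bernWeight p W (A i))
  simp only [mul_ite, mul_one, mul_zero, ← sum_filter]
  linarith

/-- If `m (1 - α log 2) < 1`, then the sumsets of `m` independent copies almost surely have a
common nonzero element: infinitely many independent windows succeed with probability bounded
below. -/
lemma trivialInterProb_eq_zero {α : ℝ} (hα : 0 < α) {k : ℕ}
    (h : (k : ℝ) < (k + 1) * (α * Real.log 2)) : trivialInterProb α (k + 1) = 0 := by
  classical
  obtain ⟨c, hc, hwin⟩ := exists_window hα h
  choose Wf hWf hcW using hwin
  -- The `n`-th window is contained in `(N n, N (n + 1)]`.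
  set N : ℕ → ℕ := fun n => Nat.rec 0 (fun _ x => x + (Wf x).sup id) n with hN
  have hNs : ∀ n, N (n + 1) = N n + (Wf (N n)).sup id := fun n => rfl
  have hmono : Monotone N := monotone_nat_of_le_succ fun n => by rw [hNs]; omega
  set W : ℕ → Finset ℕ := fun n => Wf (N n) with hW
  have hpos : ∀ n, ∀ j ∈ W n, 0 < j := fun n j hj => (Nat.zero_le _).trans_lt (hWf _ j hj)
  have hdisj : ∀ n n', n < n' → Disjoint (W n) (W n') := by
    intro n n' hn
    rw [Finset.disjoint_left]
    intro j hj hj'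
    have h1 : j ≤ (Wf (N n)).sup id := le_sup (f := id) hj
    have h2 := hWf _ j hj'
    have h3 := hmono (Nat.succ_le_of_lt hn)
    rw [Nat.succ_eq_add_one, hNs] at h3
    omega
  have hbound : ∀ K : ℕ, trivialInterProb α (k + 1) ≤ ENNReal.ofReal ((1 - c) ^ K) := by
    intro K
    set T : Fin K → Finset (Fin (k + 1) → Finset ℕ) := fun r =>
      (Fintype.piFinset fun _ : Fin (k + 1) => (W r).powerset).filter
        (fun A => ¬ HasCommonSum A) with hT
    have hsub : {X : Fin (k + 1) → ℕ+ → ℕ | (⋂ i, sumset (X i)) = {0}} ⊆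
        ⋃ A ∈ Fintype.piFinset T,
          Set.pi Set.univ fun i => {x | ∀ r : Fin K, trace x (W r) = A r i} := by
      intro X hX
      simp only [Set.mem_iUnion]
      refine ⟨fun r i => trace (X i) (W r), Fintype.mem_piFinset.2 fun r => ?_, by simp⟩
      rw [hT, mem_filter]
      refine ⟨Fintype.mem_piFinset.2 fun i => mem_powerset.2 (filter_subset _ _), fun hcs => ?_⟩
      exact iInter_sumset_ne_of_hasCommonSum (hpos r) hcs hX
    have hprob : ∀ A ∈ Fintype.piFinset T,
        (Measure.pi fun _ : Fin (k + 1) => poissonSeqLaw α)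
          (Set.pi Set.univ fun i => {x | ∀ r : Fin K, trace x (W r) = A r i}) =
        ENNReal.ofReal (∏ r : Fin K, ∏ i, bernWeight (hitProb α) (W r) (A r i)) := by
      intro A hA
      rw [Measure.pi_pi, prod_comm, ENNReal.ofReal_prod_of_nonneg]
      · refine prod_congr rfl fun i _ => ?_
        refine poissonSeqLaw_forall_trace_eq hα.le (fun r => hpos r) (fun r => ?_) ?_
        · have := Fintype.mem_piFinset.1 hA r
          rw [hT, mem_filter] at this
          exact mem_powerset.1 (Fintype.mem_piFinset.1 this.1 i)
        · intro r r' hr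
          rcases lt_or_gt_of_ne (Fin.val_ne_of_ne hr) with hlt | hlt
          · exact hdisj _ _ hlt
          · exact (hdisj _ _ hlt).symm
      · exact fun i _ => prod_nonneg fun r _ =>
          bernWeight_nonneg (hitProb_nonneg hα.le) (hitProb_le_one α) _ _
    have hnn : ∀ r (A : Fin (k + 1) → Finset ℕ),
        0 ≤ ∏ i, bernWeight (hitProb α) (W r) (A i) := fun r A =>
      prod_nonneg fun i _ => bernWeight_nonneg (hitProb_nonneg hα.le) (hitProb_le_one α) _ _
    calc trivialInterProb α (k + 1)
        ≤ ∑ A ∈ Fintype.piFinset T, (Measure.pi fun _ : Fin (k + 1) => poissonSeqLaw α)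
          (Set.pi Set.univ fun i => {x | ∀ r : Fin K, trace x (W r) = A r i}) :=
          (measure_mono hsub).trans (measure_biUnion_finset_le _ _)
      _ = ENNReal.ofReal (∑ A ∈ Fintype.piFinset T,
            ∏ r : Fin K, ∏ i, bernWeight (hitProb α) (W r) (A r i)) := by
          rw [ENNReal.ofReal_sum_of_nonneg]
          · exact sum_congr rfl hprob
          · exact fun A _ => prod_nonneg fun r _ => hnn r _
      _ = ENNReal.ofReal (∏ r : Fin K, ∑ A ∈ T r,
            ∏ i, bernWeight (hitProb α) (W r) (A i)) := by rw [prod_univ_sum]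
      _ ≤ ENNReal.ofReal (∏ r : Fin K, (1 - c)) := by
          refine ENNReal.ofReal_le_ofReal (prod_le_prod (fun r _ => sum_nonneg fun A _ => hnn r A)
            fun r _ => ?_)
          rw [hT, sum_not_hasCommonSum]
          have := hcW (N r)
          simp only [hW]
          linarith
      _ = _ := by simp
  have hc1 : c ≤ 1 := by
    have h1 := hcW 0
    have h2 := sum_not_hasCommonSum (p := hitProb α) (Wf 0) (k + 1)
    have h3 : 0 ≤ ∑ A ∈ (Fintype.piFinset fun _ : Fin (k + 1) => (Wf 0).powerset).filter
        (fun A => ¬ HasCommonSum A), ∏ i, bernWeight (hitProb α) (Wf 0) (A i) :=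
      sum_nonneg fun A _ => prod_nonneg fun i _ =>
        bernWeight_nonneg (hitProb_nonneg hα.le) (hitProb_le_one α) _ _
    linarith
  have hlim : Filter.Tendsto (fun K : ℕ => ENNReal.ofReal ((1 - c) ^ K)) Filter.atTop (nhds 0) := by
    rw [← ENNReal.ofReal_zero]
    exact ENNReal.tendsto_ofReal (tendsto_pow_atTop_nhds_zero_of_lt_one (by linarith) (by linarith))
  exact le_antisymm (ge_of_tendsto' hlim hbound) zero_le

/-! ### Finite families of independent Poisson variables -/

section

variable {κ : Type*} [Fintype κ]

/-- The law of independent Poisson variables with rates `r`. -/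
noncomputable def poissonPi (r : κ → ℝ≥0) : Measure (κ → ℕ) :=
  Measure.pi fun j => poissonMeasure (r j)

instance (r : κ → ℝ≥0) : IsProbabilityMeasure (poissonPi r) := by
  unfold poissonPi; infer_instance

lemma poissonPi_singleton (r : κ → ℝ≥0) (y : κ → ℕ) :
    poissonPi r {y} = ∏ j, poissonMeasure (r j) {y j} :=
  Measure.pi_singleton _ _

lemma poissonPi_eq_tsum (r : κ → ℝ≥0) (S : Set (κ → ℕ)) :
    poissonPi r S = ∑' y, S.indicator (fun y => poissonPi r {y}) y :=
  (Measure.tsum_indicator_apply_singleton _ S MeasurableSet.of_discrete).symm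

lemma tsum_poissonPi_singleton (r : κ → ℝ≥0) : ∑' y, poissonPi r {y} = 1 := by
  rw [← measure_univ (μ := poissonPi r), poissonPi_eq_tsum]
  simp

/-- Splitting a Poisson variable of mean `r` evenly into two independent parts: given the total
`x + z`, the split `(x, z)` has probability at least `2 ^ (-(x + z))`. -/
lemma poissonMeasure_add_le (r : ℝ≥0) (x z : ℕ) :
    poissonMeasure r {x + z} ≤
      2 ^ (x + z) * (poissonMeasure (r / 2) {x} * poissonMeasure (r / 2) {z}) := by
  have h2 : (2 : ℝ≥0∞) ^ (x + z) = ENNReal.ofReal (2 ^ (x + z)) := by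
    rw [ENNReal.ofReal_pow two_pos.le, ENNReal.ofReal_ofNat]
  simp only [poissonMeasure_singleton]
  rw [h2, ← ENNReal.ofReal_mul (by positivity), ← ENNReal.ofReal_mul (by positivity)]
  refine ENNReal.ofReal_le_ofReal ?_
  have hexp : Real.exp (-(r : ℝ)) =
      Real.exp (-((r / 2 : ℝ≥0) : ℝ)) * Real.exp (-((r / 2 : ℝ≥0) : ℝ)) := by
    rw [← Real.exp_add]; push_cast; congr 1; ring
  have hfact : ((x.factorial * z.factorial : ℕ) : ℝ) ≤ (x + z).factorial := by
    exact_mod_cast Nat.le_of_dvd (Nat.factorial_pos _)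
      (Nat.factorial_mul_factorial_dvd_factorial_add x z)
  have hpow : (2 : ℝ) ^ (x + z) * (((r / 2 : ℝ≥0) : ℝ) ^ x * ((r / 2 : ℝ≥0) : ℝ) ^ z) =
      (r : ℝ) ^ (x + z) := by
    rw [← pow_add, ← mul_pow]; push_cast; congr 1; ring
  calc Real.exp (-(r : ℝ)) * r ^ (x + z) / (x + z).factorial
      ≤ Real.exp (-(r : ℝ)) * r ^ (x + z) / ((x.factorial * z.factorial : ℕ) : ℝ) := by
        gcongr
    _ = _ := by
        rw [hexp, ← hpow]; push_cast; field_simp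

lemma poissonMeasure_succ_mul (r : ℝ≥0) (n : ℕ) :
    poissonMeasure r {n + 1} * (n + 1 : ℕ) = r * poissonMeasure r {n} := by
  simp only [poissonMeasure_singleton]
  rw [← ENNReal.ofReal_natCast, ← ENNReal.ofReal_coe_nnreal,
    ← ENNReal.ofReal_mul (by positivity), ← ENNReal.ofReal_mul (by positivity)]
  congr 1
  rw [Nat.factorial_succ]
  push_cast
  field_simp
  ring

lemma poissonMeasure_mul_pow (r θ : ℝ≥0) (n : ℕ) :
    poissonMeasure r {n} * (θ : ℝ≥0∞) ^ n =
      ENNReal.ofReal (Real.exp ((θ - 1) * r)) * poissonMeasure (θ * r) {n} := by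
  simp only [poissonMeasure_singleton]
  rw [← ENNReal.ofReal_coe_nnreal, ← ENNReal.ofReal_pow (by positivity),
    ← ENNReal.ofReal_mul (by positivity), ← ENNReal.ofReal_mul (by positivity)]
  congr 1
  have : Real.exp (-(r : ℝ)) = Real.exp ((θ - 1) * r) * Real.exp (-((θ * r : ℝ≥0) : ℝ)) := by
    rw [← Real.exp_add]; push_cast; congr 1; ring
  rw [this]
  push_cast
  rw [mul_pow]
  ring

/-- If each configuration in `S` has at most `K` points and a sub-configuration in `T`, then a
random thinning of it lies in `T` with conditional probability at least `2 ^ (-K)`. -/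
lemma poissonPi_le_two_pow_mul (r : κ → ℝ≥0) {S T : Set (κ → ℕ)} {K : ℕ}
    (hT : ∀ y ∈ S, ∃ x ∈ T, x ≤ y) (hK : ∀ y ∈ S, ∑ j, y j ≤ K) :
    poissonPi r S ≤ 2 ^ K * poissonPi (fun j => r j / 2) T := by
  classical
  have hT' : ∀ y, ∃ x, x ≤ y ∧ (y ∈ S → x ∈ T) := fun y => by
    by_cases hy : y ∈ S
    · obtain ⟨x, hx, hxy⟩ := hT y hy
      exact ⟨x, hxy, fun _ => hx⟩
    · exact ⟨y, le_rfl, fun h => absurd h hy⟩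
  choose f hf hfT using hT'
  set ν := poissonPi fun j => r j / 2 with hν
  set φ : (κ → ℕ) → (κ → ℕ) × (κ → ℕ) := fun y => (f y, y - f y) with hφ
  have hinj : Function.Injective φ := by
    intro y y' h
    have h1 : f y = f y' := congrArg Prod.fst h
    have h2 : y - f y = y' - f y' := congrArg Prod.snd h
    rw [← tsub_add_cancel_of_le (hf y), ← tsub_add_cancel_of_le (hf y'), h2, h1]
  calc poissonPi r S = ∑' y, S.indicator (fun y => poissonPi r {y}) y := poissonPi_eq_tsum r S
    _ ≤ ∑' y, 2 ^ K * (T.indicator (fun x => ν {x}) (φ y).1 * ν {(φ y).2}) := by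
        refine ENNReal.tsum_le_tsum fun y => ?_
        by_cases hy : y ∈ S
        swap
        · rw [Set.indicator_of_notMem hy]; exact zero_le
        rw [Set.indicator_of_mem hy, Set.indicator_of_mem (hfT y hy), poissonPi_singleton, hν,
          poissonPi_singleton, poissonPi_singleton, ← prod_mul_distrib]
        calc ∏ j, poissonMeasure (r j) {y j}
            ≤ ∏ j, 2 ^ (y j) * (poissonMeasure (r j / 2) {(φ y).1 j} *
                poissonMeasure (r j / 2) {(φ y).2 j}) := by
              refine prod_le_prod' fun j _ => ?_
              have := poissonMeasure_add_le (r j) (f y j) (y j - f y j)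
              rwa [add_tsub_cancel_of_le (hf y j)] at this
          _ = 2 ^ (∑ j, y j) * ∏ j, (poissonMeasure (r j / 2) {(φ y).1 j} *
                poissonMeasure (r j / 2) {(φ y).2 j}) := by
              rw [prod_mul_distrib, prod_pow_eq_pow_sum]
          _ ≤ _ := by
              gcongr
              · exact one_le_two
              · exact hK y hy
    _ ≤ ∑' z : (κ → ℕ) × (κ → ℕ), 2 ^ K * (T.indicator (fun x => ν {x}) z.1 * ν {z.2}) :=
        ENNReal.tsum_comp_le_tsum_of_injective hinj
          (fun z => 2 ^ K * (T.indicator (fun x => ν {x}) z.1 * ν {z.2}))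
    _ = 2 ^ K * ν T := by
        rw [ENNReal.tsum_mul_left, ENNReal.tsum_prod']
        simp only [ENNReal.tsum_mul_left, hν, tsum_poissonPi_singleton, mul_one]
        rw [← poissonPi_eq_tsum]

/-- The size-bias identity for Poisson variables: weighting by `y j` amounts to adding one point
at `j`. -/
lemma tsum_mul_poissonPi_singleton (r : κ → ℝ≥0) (j : κ) [DecidableEq κ] (F : (κ → ℕ) → ℝ≥0∞) :
    ∑' y : κ → ℕ, (y j : ℝ≥0∞) * poissonPi r {y} * F y =
      r j * ∑' y, poissonPi r {y} * F (y + Pi.single j 1) := by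
  have hinj : Function.Injective fun y : κ → ℕ => y + Pi.single j 1 := add_left_injective _
  rw [← hinj.tsum_eq, ← ENNReal.tsum_mul_left]
  · refine tsum_congr fun y => ?_
    rw [← mul_assoc (r j : ℝ≥0∞)]
    congr 1
    rw [poissonPi_singleton, poissonPi_singleton, ← mul_prod_erase univ _ (mem_univ j),
      ← mul_prod_erase univ (fun i => poissonMeasure (r i) {y i}) (mem_univ j), ← mul_assoc,
      ← mul_assoc, ← poissonMeasure_succ_mul]
    congr 1
    · simp [mul_comm]
    · refine prod_congr rfl fun i hi => ?_
      rw [Pi.add_apply, Pi.single_eq_of_ne (ne_of_mem_erase hi), add_zero]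
  · intro y hy
    have hj : y j ≠ 0 := by
      rintro h
      simp [h] at hy
    refine ⟨y - Pi.single j 1, tsub_add_cancel_of_le fun i => ?_⟩
    by_cases hij : i = j
    · subst hij
      simpa using Nat.one_le_iff_ne_zero.2 hj
    · simp [Pi.single_eq_of_ne hij]

/-- A weighted Poisson sum in which every weight `v j` has the same expected contribution `a`
takes the value `n` with probability at most `a / n`. -/
lemma mul_poissonPi_sum_eq_le (r : κ → ℝ≥0) {v : κ → ℕ} (hv : Function.Injective v) {a : ℝ≥0∞}
    (ha : ∀ j, v j * (r j : ℝ≥0∞) = a) (n : ℕ) :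
    (n : ℝ≥0∞) * poissonPi r {y | ∑ j, v j * y j = n} ≤ a := by
  classical
  set F : (κ → ℕ) → ℝ≥0∞ := fun y => if ∑ j, v j * y j = n then 1 else 0 with hF
  have h1 : poissonPi r {y | ∑ j, v j * y j = n} = ∑' y, poissonPi r {y} * F y := by
    rw [poissonPi_eq_tsum]
    refine tsum_congr fun y => ?_
    simp only [Set.indicator_apply, Set.mem_ofPred_eq, hF, mul_ite, mul_one, mul_zero]
  have h2 : ∀ y, (n : ℝ≥0∞) * (poissonPi r {y} * F y) =
      ∑ j, (v j : ℝ≥0∞) * ((y j : ℝ≥0∞) * poissonPi r {y} * F y) := by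
    intro y
    simp only [hF]
    split_ifs with h
    · simp only [← h, mul_one, ← mul_assoc, ← sum_mul]
      push_cast
      rfl
    · simp
  have h3 : ∀ y : κ → ℕ, ∑ j, F (y + Pi.single j 1) ≤ 1 := by
    intro y
    have hs : ∀ j, ∑ i, v i * (y + Pi.single j 1 : κ → ℕ) i = ∑ i, v i * y i + v j := by
      intro j
      simp [mul_add, sum_add_distrib, Pi.single_apply]
    simp only [hF, hs, sum_boole]
    exact_mod_cast card_le_one.2 fun i hi j hj => by
      simp only [mem_filter, mem_univ, true_and] at hi hj
      exact hv (by omega)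
  calc (n : ℝ≥0∞) * poissonPi r {y | ∑ j, v j * y j = n}
      = ∑' y, ∑ j, (v j : ℝ≥0∞) * ((y j : ℝ≥0∞) * poissonPi r {y} * F y) := by
        rw [h1, ← ENNReal.tsum_mul_left]
        exact tsum_congr h2
    _ = ∑ j, a * ∑' y, poissonPi r {y} * F (y + Pi.single j 1) := by
        rw [Summable.tsum_finsetSum fun _ _ => ENNReal.summable]
        refine sum_congr rfl fun j _ => ?_
        rw [ENNReal.tsum_mul_left, tsum_mul_poissonPi_singleton, ← mul_assoc, ha]
    _ = a * ∑' y, poissonPi r {y} * ∑ j, F (y + Pi.single j 1) := by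
        rw [← mul_sum, ← Summable.tsum_finsetSum fun _ _ => ENNReal.summable]
        simp only [mul_sum]
    _ ≤ a * ∑' y, poissonPi r {y} * 1 := by
        gcongr with y
        exact h3 y
    _ = a := by simp [tsum_poissonPi_singleton]

/-- Chernoff's bound for the total number of points. -/
lemma poissonPi_le_sum_le (r : κ → ℝ≥0) {θ : ℝ≥0} (hθ : 1 ≤ θ) (L : ℕ) :
    poissonPi r {y | L ≤ ∑ j, y j} ≤
      ENNReal.ofReal (Real.exp ((θ - 1) * ∑ j, (r j : ℝ)) / θ ^ L) := by
  have hθ0 : 0 < (θ : ℝ) := lt_of_lt_of_le one_pos (by exact_mod_cast hθ)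
  have h1 : ∀ y : κ → ℕ, poissonPi r {y} * (θ : ℝ≥0∞) ^ (∑ j, y j) =
      ENNReal.ofReal (Real.exp ((θ - 1) * ∑ j, (r j : ℝ))) *
        poissonPi (fun j => θ * r j) {y} := by
    intro y
    rw [poissonPi_singleton, poissonPi_singleton, ← prod_pow_eq_pow_sum, ← prod_mul_distrib,
      mul_sum, Real.exp_sum, ENNReal.ofReal_prod_of_nonneg fun _ _ => (Real.exp_pos _).le,
      ← prod_mul_distrib]
    exact prod_congr rfl fun j _ => poissonMeasure_mul_pow _ _ _
  have h2 : (θ : ℝ≥0∞) ^ L * poissonPi r {y | L ≤ ∑ j, y j} ≤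
      ENNReal.ofReal (Real.exp ((θ - 1) * ∑ j, (r j : ℝ))) := by
    rw [poissonPi_eq_tsum, ← ENNReal.tsum_mul_left]
    calc _ ≤ ∑' y, ENNReal.ofReal (Real.exp ((θ - 1) * ∑ j, (r j : ℝ))) *
          poissonPi (fun j => θ * r j) {y} := by
          refine ENNReal.tsum_le_tsum fun y => ?_
          rw [← h1]
          by_cases hy : L ≤ ∑ j, y j
          · rw [Set.indicator_of_mem (by exact hy), mul_comm]
            gcongr
            exact_mod_cast hθ
          · rw [Set.indicator_of_notMem (by exact hy), mul_zero]; exact zero_le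
      _ = _ := by rw [ENNReal.tsum_mul_left, tsum_poissonPi_singleton, mul_one]
  rw [ENNReal.ofReal_div_of_pos (by positivity),
    ENNReal.le_div_iff_mul_le (Or.inl (ENNReal.ofReal_pos.2 (by positivity)).ne')
      (Or.inl ENNReal.ofReal_ne_top), mul_comm,
    ENNReal.ofReal_pow hθ0.le, ENNReal.ofReal_coe_nnreal]
  exact h2

end

/-! ### Hits in dyadic blocks -/

/-- The positive integers up to `N`. -/
def pnatsUpTo (N : ℕ) : Finset ℕ+ :=
  (range N).map ⟨Nat.succPNat, Nat.succPNat_injective⟩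

lemma mem_pnatsUpTo {N : ℕ} {j : ℕ+} : j ∈ pnatsUpTo N ↔ (j : ℕ) ≤ N := by
  simp only [pnatsUpTo, mem_map, mem_range, Function.Embedding.coeFn_mk]
  constructor
  · rintro ⟨i, hi, rfl⟩
    simpa using hi
  · intro h
    refine ⟨j.natPred, ?_, PNat.succPNat_natPred j⟩
    have := PNat.natPred_add_one j
    omega

lemma sum_pnatsUpTo_inv_le (N : ℕ) : ∑ j ∈ pnatsUpTo N, (1 / (j : ℕ) : ℝ) ≤ 1 + Real.log N := by
  refine le_trans (le_of_eq ?_) (harmonic_le_one_add_log N)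
  rw [pnatsUpTo, sum_map, harmonic]
  push_cast
  exact sum_congr rfl fun i _ => by simp

/-- The rates of the first `N` coordinates. -/
noncomputable def initialRates (α : ℝ) (N : ℕ) (j : pnatsUpTo N) : ℝ≥0 :=
  Real.toNNReal (α / (j : ℕ+))

lemma poissonSeqLaw_restrict_preimage (α : ℝ) (N : ℕ) (S : Set (pnatsUpTo N → ℕ)) :
    poissonSeqLaw α ((pnatsUpTo N).restrict ⁻¹' S) = poissonPi (initialRates α N) S := by
  have h := Measure.infinitePi_map_restrict
    (fun j : ℕ+ => poissonMeasure (Real.toNNReal (α / (j : ℕ)))) (I := pnatsUpTo N)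
  have h2 : poissonPi (initialRates α N) = (poissonSeqLaw α).map (pnatsUpTo N).restrict := h.symm
  rw [h2, Measure.map_apply (Finset.measurable_restrict _) MeasurableSet.of_discrete]

lemma le_of_mem_support {x : ℕ+ →₀ ℕ} {n : ℕ}
    (hn : n = x.sum fun j k => (j : ℕ) * k) {j : ℕ+} (hj : j ∈ x.support) : (j : ℕ) ≤ n := by
  rw [hn, Finsupp.sum]
  have h1 : 1 ≤ x j := Nat.one_le_iff_ne_zero.2 (Finsupp.mem_support_iff.1 hj)
  calc (j : ℕ) ≤ (j : ℕ) * x j := Nat.le_mul_of_pos_right _ h1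
    _ ≤ _ := single_le_sum (f := fun j : ℕ+ => (j : ℕ) * x j) (fun _ _ => Nat.zero_le _) hj

/-- The probability that `n` is a subset sum while there are at most `K` points up to `N ≥ n`. -/
lemma poissonSeqLaw_mem_sumset_le {α : ℝ} (hα : 0 ≤ α) {n N : ℕ} (hn : 0 < n) (hN : n ≤ N)
    (K : ℕ) :
    poissonSeqLaw α {X | n ∈ sumset X ∧ ∑ j ∈ pnatsUpTo N, X j ≤ K} ≤
      ENNReal.ofReal (2 ^ K * (α / 2) / n) := by
  set S : Set (pnatsUpTo N → ℕ) :=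
    {y | (∃ x ≤ y, ∑ j : pnatsUpTo N, ((j : ℕ+) : ℕ) * x j = n) ∧ ∑ j, y j ≤ K} with hS
  have hsub : {X | n ∈ sumset X ∧ ∑ j ∈ pnatsUpTo N, X j ≤ K} ⊆
      (pnatsUpTo N).restrict ⁻¹' S := by
    rintro X ⟨⟨x, hx, hxn⟩, hK⟩
    refine ⟨⟨fun j => x j, fun j => hx j, ?_⟩, ?_⟩
    · rw [sum_coe_sort (pnatsUpTo N) (fun j => (j : ℕ) * x j), hxn, Finsupp.sum]
      refine (sum_subset (fun j hj => mem_pnatsUpTo.2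
        ((le_of_mem_support hxn hj).trans hN)) fun j _ hj => ?_).symm
      rw [Finsupp.notMem_support_iff.1 hj, mul_zero]
    · simp only [Finset.restrict]
      rwa [sum_coe_sort (pnatsUpTo N) X]
  have h1 : poissonPi (initialRates α N) S ≤ 2 ^ K *
      poissonPi (fun j => initialRates α N j / 2)
        {y | ∑ j : pnatsUpTo N, ((j : ℕ+) : ℕ) * y j = n} :=
    poissonPi_le_two_pow_mul _ (fun y hy => by
      obtain ⟨⟨x, hxy, hx⟩, _⟩ := hy
      exact ⟨x, hx, hxy⟩) fun y hy => hy.2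
  have h2 := mul_poissonPi_sum_eq_le (fun j => initialRates α N j / 2)
    (v := fun j : pnatsUpTo N => ((j : ℕ+) : ℕ)) (fun i j hij => Subtype.ext (PNat.eq hij))
    (a := ENNReal.ofReal (α / 2)) (fun j => by
      have hj : (0 : ℝ) < ((j : ℕ+) : ℕ) := by exact_mod_cast (j : ℕ+).pos
      rw [← ENNReal.ofReal_natCast, ← ENNReal.ofReal_coe_nnreal,
        ← ENNReal.ofReal_mul (by positivity), initialRates]
      congr 1
      push_cast
      rw [Real.coe_toNNReal _ (by positivity)]
      field_simp) n
  have hn' : (0 : ℝ) < n := by exact_mod_cast hn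
  have h3 : poissonPi (fun j => initialRates α N j / 2)
      {y | ∑ j : pnatsUpTo N, ((j : ℕ+) : ℕ) * y j = n} ≤
      ENNReal.ofReal (α / 2 / n) := by
    rw [ENNReal.ofReal_div_of_pos hn', ENNReal.ofReal_natCast,
      ENNReal.le_div_iff_mul_le (Or.inl (by simpa using hn.ne')) (Or.inl (by simp)), mul_comm]
    exact h2
  calc _ ≤ poissonPi (initialRates α N) S :=
        (measure_mono hsub).trans_eq (poissonSeqLaw_restrict_preimage α N S)
    _ ≤ 2 ^ K * ENNReal.ofReal (α / 2 / n) := h1.trans (by gcongr)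
    _ = _ := by
        rw [mul_div_assoc, ENNReal.ofReal_mul (by positivity), ENNReal.ofReal_pow two_pos.le,
          ENNReal.ofReal_ofNat]

lemma poissonSeqLaw_le_sum_le {α : ℝ} (hα : 0 ≤ α) {θ : ℝ≥0} (hθ : 1 ≤ θ) (N L : ℕ) :
    poissonSeqLaw α {X | L ≤ ∑ j ∈ pnatsUpTo N, X j} ≤
      ENNReal.ofReal (Real.exp ((θ - 1) * (α * (1 + Real.log N))) / θ ^ L) := by
  have hset : {X : ℕ+ → ℕ | L ≤ ∑ j ∈ pnatsUpTo N, X j} =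
      (pnatsUpTo N).restrict ⁻¹' {y | L ≤ ∑ j, y j} := by
    ext X
    simp only [Set.mem_preimage, Set.mem_ofPred_eq, Finset.restrict]
    rw [sum_coe_sort (pnatsUpTo N) X]
  have hsum : ∑ j, (initialRates α N j : ℝ) ≤ α * (1 + Real.log N) := by
    calc ∑ j, (initialRates α N j : ℝ) = ∑ j : pnatsUpTo N, α * (1 / ((j : ℕ+) : ℕ) : ℝ) := by
          refine sum_congr rfl fun j _ => ?_
          rw [initialRates, Real.coe_toNNReal _ (by positivity)]
          ring
      _ = α * ∑ j ∈ pnatsUpTo N, (1 / (j : ℕ) : ℝ) := by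
          rw [← mul_sum, sum_coe_sort (pnatsUpTo N) (fun j => (1 / (j : ℕ) : ℝ))]
      _ ≤ _ := by gcongr; exact sum_pnatsUpTo_inv_le N
  have hθ0 : (1 : ℝ) ≤ θ := by exact_mod_cast hθ
  rw [hset, poissonSeqLaw_restrict_preimage]
  refine (poissonPi_le_sum_le _ hθ L).trans (ENNReal.ofReal_le_ofReal ?_)
  have : 0 ≤ (θ : ℝ) - 1 := by linarith
  gcongr

/-- Some integer in `[2 ^ k, 2 ^ (k + 1))` belongs to all the sumsets. -/
def blockHit (m k : ℕ) : Set (Fin m → ℕ+ → ℕ) :=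
  {X | ∃ n ∈ Ico (2 ^ k) (2 ^ (k + 1)), ∀ i, n ∈ sumset (X i)}

/-- A union bound, after discarding the event that one of the copies has more than `K` points up to
`2 ^ (k + 1)`. -/
lemma measure_blockHit_le {α : ℝ} (hα : 0 ≤ α) {θ : ℝ≥0} (hθ : 1 ≤ θ) (m k K : ℕ) :
    (Measure.pi fun _ : Fin m => poissonSeqLaw α) (blockHit m k) ≤
      ENNReal.ofReal (m * (Real.exp ((θ - 1) * (α * (1 + (k + 1) * Real.log 2))) / θ ^ (K + 1)) +
        2 ^ k * (2 ^ K * (α / 2) / 2 ^ k) ^ m) := by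
  set N := 2 ^ (k + 1) with hN
  set tail : Set (ℕ+ → ℕ) := {x | K + 1 ≤ ∑ j ∈ pnatsUpTo N, x j} with htail
  set E : ℕ → Set (ℕ+ → ℕ) := fun n => {x | n ∈ sumset x ∧ ∑ j ∈ pnatsUpTo N, x j ≤ K} with hE
  have hmeas : MeasurableSet tail :=
    measurableSet_le measurable_const (Finset.measurable_sum _ fun j _ => measurable_pi_apply j)
  have hsub : blockHit m k ⊆ (⋃ i : Fin m, Function.eval i ⁻¹' tail) ∪
      ⋃ n ∈ Ico (2 ^ k) (2 ^ (k + 1)), Set.pi Set.univ fun _ : Fin m => E n := by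
    rintro X ⟨n, hn, hX⟩
    by_cases h : ∃ i, X i ∈ tail
    · exact Or.inl (Set.mem_iUnion.2 h)
    · push Not at h
      refine Or.inr (Set.mem_biUnion hn fun i _ => ⟨hX i, ?_⟩)
      have := h i
      simp only [htail, Set.mem_ofPred_eq, not_le] at this
      omega
  have hlogN : Real.log N = (k + 1) * Real.log 2 := by
    rw [hN]; push_cast; rw [Real.log_pow]; push_cast; ring
  set t := Real.exp ((θ - 1) * (α * (1 + (k + 1) * Real.log 2))) / (θ : ℝ) ^ (K + 1) with ht
  have htail' : ∀ i : Fin m, (Measure.pi fun _ : Fin m => poissonSeqLaw α)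
      (Function.eval i ⁻¹' tail) ≤ ENNReal.ofReal t := by
    intro i
    rw [(measurePreserving_eval (fun _ : Fin m => poissonSeqLaw α) i).measure_preimage
      hmeas.nullMeasurableSet]
    have := poissonSeqLaw_le_sum_le hα hθ N (K + 1)
    rwa [hlogN] at this
  set e : ℝ := 2 ^ K * (α / 2) / 2 ^ k with he
  have he0 : 0 ≤ e := by positivity
  have ht0 : 0 ≤ t := by positivity
  have hE' : ∀ n ∈ Ico (2 ^ k) (2 ^ (k + 1)), (Measure.pi fun _ : Fin m => poissonSeqLaw α)
      (Set.pi Set.univ fun _ : Fin m => E n) ≤ ENNReal.ofReal (e ^ m) := by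
    intro n hn
    rw [mem_Ico] at hn
    have hn0 : 0 < n := lt_of_lt_of_le (by positivity) hn.1
    have hn1 : (2 : ℝ) ^ k ≤ n := by exact_mod_cast hn.1
    rw [Measure.pi_pi, prod_const, card_univ, Fintype.card_fin, ENNReal.ofReal_pow he0]
    gcongr
    refine (poissonSeqLaw_mem_sumset_le hα hn0 hn.2.le K).trans (ENNReal.ofReal_le_ofReal ?_)
    rw [he]
    gcongr
  calc _ ≤ ∑ i : Fin m, ENNReal.ofReal t +
        ∑ n ∈ Ico (2 ^ k) (2 ^ (k + 1)), ENNReal.ofReal (e ^ m) := by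
        refine (measure_mono hsub).trans ((measure_union_le _ _).trans (add_le_add ?_ ?_))
        · refine (measure_iUnion_le _).trans ?_
          rw [tsum_fintype]
          exact sum_le_sum fun i _ => htail' i
        · exact (measure_biUnion_finset_le _ _).trans (sum_le_sum hE')
    _ = _ := by
        rw [← ENNReal.ofReal_sum_of_nonneg fun _ _ => ht0,
          ← ENNReal.ofReal_sum_of_nonneg fun _ _ => pow_nonneg he0 m,
          ← ENNReal.ofReal_add (sum_nonneg fun _ _ => ht0)
            (sum_nonneg fun _ _ => pow_nonneg he0 m)]
        congr 1
        rw [sum_const, sum_const, card_univ, Fintype.card_fin, Nat.card_Ico, pow_succ, mul_two,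
          Nat.add_sub_cancel, nsmul_eq_mul, nsmul_eq_mul]
        push_cast
        rfl

/-- If `m (1 - α log 2) > 1`, the probabilities of the dyadic hits are summable: at most
`σ (k + 1)` points up to `2 ^ (k + 1)` are expected, for any `σ > α log 2`. -/
lemma tsum_measure_blockHit_ne_top {α : ℝ} (hα : 0 < α) {m : ℕ}
    (h : 1 < m * (1 - α * Real.log 2)) :
    ∑' k, (Measure.pi fun _ : Fin m => poissonSeqLaw α) (blockHit m k) ≠ ∞ := by
  have hlog : 0 < Real.log 2 := Real.log_pos one_lt_two
  have hm : (0 : ℝ) < m := by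
    rcases Nat.eq_zero_or_pos m with rfl | hm
    · norm_num at h
    · exact_mod_cast hm
  have hal : 0 < α * Real.log 2 := mul_pos hα hlog
  obtain ⟨σ, hσ1, hσ2⟩ : ∃ σ, α * Real.log 2 < σ ∧ 1 < m * (1 - σ) := by
    obtain ⟨σ, h1, h2⟩ := exists_between (show α * Real.log 2 < 1 - 1 / m by
      have : 1 / (m : ℝ) < 1 - α * Real.log 2 := by rw [div_lt_iff₀' hm]; exact h
      linarith)
    refine ⟨σ, h1, ?_⟩
    rw [← div_lt_iff₀' hm]; linarith
  have hσ0 : 0 < σ := hal.trans hσ1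
  obtain ⟨θ', hθ1, hθ2⟩ := exists_between ((one_lt_div hal).2 hσ1)
  have hθ0 : 0 < θ' := one_pos.trans hθ1
  set θ : ℝ≥0 := ⟨θ', hθ0.le⟩ with hθ
  have hθc : (θ : ℝ) = θ' := rfl
  have hθ1' : 1 ≤ θ := by exact_mod_cast hθ1.le
  -- The geometric ratios of the two terms of the bound.
  set ρ₁ := Real.exp ((θ' - 1) * (α * Real.log 2) - σ * Real.log θ') with hρ₁
  set ρ₂ := Real.exp (Real.log 2 * (1 + m * σ - m)) with hρ₂
  have hρ₁1 : ρ₁ < 1 := by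
    rw [hρ₁, Real.exp_lt_one_iff]
    have h1 : 1 - θ'⁻¹ ≤ Real.log θ' := Real.one_sub_inv_le_log_of_pos hθ0
    have h2 : θ' * (α * Real.log 2) < σ := (lt_div_iff₀ hal).1 hθ2
    have h3 : (θ' - 1) * (α * Real.log 2) < σ * (1 - θ'⁻¹) := by
      calc (θ' - 1) * (α * Real.log 2) = (1 - θ'⁻¹) * (θ' * (α * Real.log 2)) := by field_simp
        _ < (1 - θ'⁻¹) * σ := by
            have : 0 < 1 - θ'⁻¹ := by rw [sub_pos]; exact inv_lt_one_of_one_lt₀ hθ1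
            gcongr
        _ = _ := mul_comm _ _
    have h4 := mul_le_mul_of_nonneg_left h1 hσ0.le
    linarith
  have hρ₂1 : ρ₂ < 1 := by
    rw [hρ₂, Real.exp_lt_one_iff]
    exact mul_neg_of_pos_of_neg hlog (by linarith)
  set c₁ := m * Real.exp ((θ' - 1) * α + ((θ' - 1) * (α * Real.log 2) - σ * Real.log θ')) with hc₁
  set c₂ := Real.exp (m * (σ * Real.log 2)) * (α / 2) ^ m with hc₂
  have hbound : ∀ k, (Measure.pi fun _ : Fin m => poissonSeqLaw α) (blockHit m k) ≤
      ENNReal.ofReal (c₁ * ρ₁ ^ k + c₂ * ρ₂ ^ k) := by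
    intro k
    set K := ⌊σ * (k + 1)⌋₊ with hK
    have hK1 : (K : ℝ) ≤ σ * (k + 1) := Nat.floor_le (by positivity)
    have hK2 : σ * (k + 1) ≤ K + 1 := (Nat.lt_floor_add_one _).le
    refine (measure_blockHit_le hα.le hθ1' m k K).trans (ENNReal.ofReal_le_ofReal ?_)
    rw [hθc]
    have hlogθ : 0 ≤ Real.log θ' := Real.log_nonneg hθ1.le
    refine add_le_add ?_ ?_
    · have e1 : θ' ^ (K + 1) = Real.exp ((K + 1 : ℝ) * Real.log θ') := by
        have := Real.exp_nat_mul (Real.log θ') (K + 1)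
        rw [Real.exp_log hθ0] at this
        rw [← this]; push_cast; rfl
      rw [e1, ← Real.exp_sub, hc₁, hρ₁, ← Real.exp_nat_mul, mul_assoc, ← Real.exp_add]
      gcongr
      have := mul_le_mul_of_nonneg_right hK2 hlogθ
      linarith
    · have e2 : ∀ n : ℕ, (2 : ℝ) ^ n = Real.exp (n * Real.log 2) := fun n => by
        rw [Real.exp_nat_mul, Real.exp_log two_pos]
      have h1 : (2 : ℝ) ^ K ≤ Real.exp (σ * (k + 1) * Real.log 2) := by
        rw [e2]; gcongr
      calc (2 : ℝ) ^ k * (2 ^ K * (α / 2) / 2 ^ k) ^ m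
          ≤ 2 ^ k * (Real.exp (σ * (k + 1) * Real.log 2) * (α / 2) / 2 ^ k) ^ m := by
            gcongr
        _ = c₂ * ρ₂ ^ k := by
            rw [hc₂, hρ₂, div_pow, mul_pow, ← Real.exp_nat_mul, ← Real.exp_nat_mul, ← pow_mul,
              e2, e2, mul_div_right_comm, ← Real.exp_sub, ← mul_assoc, ← Real.exp_add,
              mul_right_comm (Real.exp (m * (σ * Real.log 2))), ← Real.exp_add]
            congr 2
            push_cast
            ring
  refine ne_top_of_le_ne_top ?_ (ENNReal.tsum_le_tsum hbound)
  refine Summable.tsum_ofReal_ne_top ?_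
  exact ((summable_geometric_of_lt_one (Real.exp_pos _).le hρ₁1).mul_left _).add
    ((summable_geometric_of_lt_one (Real.exp_pos _).le hρ₂1).mul_left _)

/-! ### Trivial intersection with positive probability -/

/-- The sequence `x` with its first `N` terms replaced by zero. -/
def zeroUpTo (N : ℕ) (x : ℕ+ → ℕ) : ℕ+ → ℕ := fun j => if (j : ℕ) ≤ N then 0 else x j

lemma measurable_zeroUpTo (N : ℕ) : Measurable (zeroUpTo N) := by
  refine measurable_pi_iff.2 fun j => ?_
  unfold zeroUpTo
  split_ifs
  · exact measurable_const
  · exact measurable_pi_apply j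

lemma zero_mem_sumset (x : ℕ+ → ℕ) : 0 ∈ sumset x := ⟨0, fun _ => Nat.zero_le _, by simp⟩

lemma mem_sumset_zeroUpTo {N : ℕ} {x : ℕ+ → ℕ} {n : ℕ} (h : n ∈ sumset (zeroUpTo N x)) :
    n ∈ sumset x ∧ (n = 0 ∨ N < n) := by
  obtain ⟨y, hy, hn⟩ := h
  refine ⟨⟨y, fun j => (hy j).trans ?_, hn⟩, ?_⟩
  · unfold zeroUpTo
    split_ifs
    · exact Nat.zero_le _
    · exact le_rfl
  · rcases y.support.eq_empty_or_nonempty with h0 | ⟨j, hj⟩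
    · left
      rw [hn, Finsupp.support_eq_empty.1 h0]
      simp
    · right
      refine lt_of_lt_of_le ?_ (le_of_mem_support hn hj)
      by_contra hle
      have := hy j
      rw [zeroUpTo, if_pos (not_lt.1 hle)] at this
      exact Finsupp.mem_support_iff.1 hj (Nat.le_zero.1 this)

/-- The sequences whose first `N` terms vanish. -/
def vanishUpTo (N : ℕ) : Set (ℕ+ → ℕ) := Set.pi (pnatsUpTo N) fun _ => {0}

lemma poissonSeqLaw_vanishUpTo (α : ℝ) (N : ℕ) : poissonSeqLaw α (vanishUpTo N) =
    ∏ j ∈ pnatsUpTo N, poissonMeasure (Real.toNNReal (α / (j : ℕ))) {0} :=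
  Measure.infinitePi_pi _ fun _ _ => MeasurableSet.of_discrete

lemma poissonSeqLaw_vanishUpTo_ne_zero {α : ℝ} (hα : 0 ≤ α) (N : ℕ) :
    poissonSeqLaw α (vanishUpTo N) ≠ 0 := by
  rw [poissonSeqLaw_vanishUpTo, prod_ne_zero_iff]
  intro j _
  rw [poissonMeasure_zero_set hα, hitProb, sub_sub_cancel]
  exact (ENNReal.ofReal_pos.2 (Real.exp_pos _)).ne'

/-- Replacing the first `N` terms by zero amounts to conditioning them to vanish. -/
lemma map_zeroUpTo_poissonSeqLaw {α : ℝ} (hα : 0 ≤ α) (N : ℕ) :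
    (poissonSeqLaw α).map (zeroUpTo N) =
      (poissonSeqLaw α (vanishUpTo N))⁻¹ • (poissonSeqLaw α).restrict (vanishUpTo N) := by
  classical
  set μ : ℕ+ → Measure ℕ := fun j => poissonMeasure (Real.toNNReal (α / (j : ℕ))) with hμ
  set f : ℕ+ → ℕ → ℕ := fun j x => if (j : ℕ) ≤ N then 0 else x with hf
  have hfm : ∀ j, Measurable (f j) := fun j => measurable_from_top
  have hprob : ∀ j, IsProbabilityMeasure ((μ j).map (f j)) := fun j =>
    Measure.isProbabilityMeasure_map (hfm j).aemeasurable
  have hmap : (poissonSeqLaw α).map (zeroUpTo N) =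
      Measure.infinitePi fun j => (μ j).map (f j) := Measure.infinitePi_map_pi μ hfm
  rw [hmap]
  refine (Measure.eq_infinitePi _ fun s t ht => ?_).symm
  set t' : ℕ+ → Set ℕ := fun j =>
    (if j ∈ s then t j else Set.univ) ∩ (if j ∈ pnatsUpTo N then {0} else Set.univ) with ht'
  have hset : Set.pi s t ∩ vanishUpTo N = Set.pi ((s ∪ pnatsUpTo N : Finset ℕ+) : Set ℕ+) t' := by
    ext x
    simp only [vanishUpTo, Set.mem_inter_iff, Set.mem_pi, mem_coe, mem_union, ht']
    constructor
    · rintro ⟨h1, h2⟩ j _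
      constructor
      · split_ifs with h
        · exact h1 j h
        · trivial
      · split_ifs with h
        · exact h2 j h
        · trivial
    · intro h
      refine ⟨fun j hj => ?_, fun j hj => ?_⟩
      · have := (h j (Or.inl hj)).1
        rwa [if_pos hj] at this
      · have := (h j (Or.inr hj)).2
        rwa [if_pos hj] at this
  have hfac : ∀ j, μ j (t' j) = (μ j).map (f j) (if j ∈ s then t j else Set.univ) *
      (if j ∈ pnatsUpTo N then μ j {0} else 1) := by
    intro j
    set u := (if j ∈ s then t j else Set.univ) with hu
    rw [Measure.map_apply (hfm j) MeasurableSet.of_discrete]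
    by_cases hj : j ∈ pnatsUpTo N
    · have hjN : (j : ℕ) ≤ N := mem_pnatsUpTo.1 hj
      simp only [ht', hj, if_true, hf, hjN]
      by_cases h0 : (0 : ℕ) ∈ u
      · have e1 : u ∩ {0} = {0} := Set.inter_eq_right.2 (Set.singleton_subset_iff.2 h0)
        have e2 : (fun _ : ℕ => (0 : ℕ)) ⁻¹' u = Set.univ := Set.preimage_const_of_mem h0
        rw [e1, e2, measure_univ, one_mul]
      · have e1 : u ∩ {0} = ∅ := Set.inter_singleton_eq_empty.2 h0
        have e2 : (fun _ : ℕ => (0 : ℕ)) ⁻¹' u = ∅ := Set.preimage_const_of_notMem h0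
        rw [e1, e2, measure_empty, zero_mul]
    · have hjN : ¬ (j : ℕ) ≤ N := fun h => hj (mem_pnatsUpTo.2 h)
      simp only [ht', hj, if_false, hf, hjN, Set.inter_univ, mul_one]
      rfl
  have hms : MeasurableSet (Set.pi (s : Set ℕ+) t) :=
    MeasurableSet.pi s.countable_toSet fun j _ => ht j
  have hc0 := poissonSeqLaw_vanishUpTo_ne_zero hα N
  rw [Measure.smul_apply, Measure.restrict_apply hms, hset, smul_eq_mul]
  have hpi : poissonSeqLaw α (Set.pi ((s ∪ pnatsUpTo N : Finset ℕ+) : Set ℕ+) t') =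
      (∏ j ∈ s, (μ j).map (f j) (t j)) * poissonSeqLaw α (vanishUpTo N) := by
    rw [poissonSeqLaw_vanishUpTo]
    refine (Measure.infinitePi_pi μ fun _ _ => MeasurableSet.of_discrete).trans ?_
    rw [prod_congr rfl fun j _ => hfac j, prod_mul_distrib]
    congr 1
    · rw [← prod_subset subset_union_left fun j _ hj => ?_]
      · exact prod_congr rfl fun j hj => by rw [if_pos hj]
      · rw [if_neg hj, measure_univ]
    · rw [← prod_subset subset_union_right fun j _ hj => ?_]
      · exact prod_congr rfl fun j hj => by rw [if_pos hj]
      · rw [if_neg hj]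
  rw [hpi, mul_comm, mul_assoc, ENNReal.mul_inv_cancel hc0 (measure_ne_top _ _), mul_one]

/-- An event which has positive probability after the first `N` terms of each copy have been
replaced by zero has positive probability. -/
lemma measure_ne_zero_of_preimage_zeroUpTo {α : ℝ} (hα : 0 ≤ α) {m N : ℕ}
    {S : Set (Fin m → ℕ+ → ℕ)}
    (h : (Measure.pi fun _ : Fin m => poissonSeqLaw α) ((fun X i => zeroUpTo N (X i)) ⁻¹' S) ≠ 0) :
    (Measure.pi fun _ : Fin m => poissonSeqLaw α) S ≠ 0 := by
  set μ := poissonSeqLaw α with hμ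
  set L := vanishUpTo N with hL
  set c := μ L with hc
  have hc0 : c ≠ 0 := poissonSeqLaw_vanishUpTo_ne_zero hα N
  have hprob : IsProbabilityMeasure (μ.map (zeroUpTo N)) :=
    Measure.isProbabilityMeasure_map (measurable_zeroUpTo N).aemeasurable
  have hpi : (Measure.pi fun _ : Fin m => μ.map (zeroUpTo N)) =
      c⁻¹ ^ m • (Measure.pi fun _ : Fin m => μ).restrict (Set.pi Set.univ fun _ => L) := by
    refine Measure.pi_eq fun s hs => ?_
    rw [Measure.smul_apply, Measure.restrict_apply (MeasurableSet.univ_pi hs),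
      ← Set.pi_inter_distrib, Measure.pi_pi, map_zeroUpTo_poissonSeqLaw hα]
    simp only [Measure.smul_apply, smul_eq_mul, prod_mul_distrib, prod_const, card_univ,
      Fintype.card_fin, Measure.restrict_apply (hs _)]
    rfl
  intro hS
  refine h (le_antisymm ?_ zero_le)
  have hmeas : Measurable fun (X : Fin m → ℕ+ → ℕ) i => zeroUpTo N (X i) :=
    measurable_pi_iff.2 fun i => (measurable_zeroUpTo N).comp (measurable_pi_apply i)
  calc _ ≤ ((Measure.pi fun _ : Fin m => μ).map fun X i => zeroUpTo N (X i)) S :=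
        Measure.le_map_apply hmeas.aemeasurable S
    _ = c⁻¹ ^ m • (Measure.pi fun _ : Fin m => μ).restrict (Set.pi Set.univ fun _ => L) S := by
        rw [Measure.pi_map_pi fun _ => (measurable_zeroUpTo N).aemeasurable, hpi,
          Measure.smul_apply]
    _ ≤ c⁻¹ ^ m • (Measure.pi fun _ : Fin m => μ) S := by
        gcongr
        exact Measure.restrict_le_self
    _ = 0 := by rw [hS, smul_zero]

/-- If `m (1 - α log 2) > 1`, then the sumsets of `m` independent copies meet only in `0` with
positive probability: their intersection is almost surely finite, and its positive elements can be
removed by letting finitely many terms of each sequence vanish. -/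
lemma trivialInterProb_pos {α : ℝ} (hα : 0 < α) {m : ℕ} (h : 1 < m * (1 - α * Real.log 2)) :
    0 < trivialInterProb α m := by
  set P := Measure.pi fun _ : Fin m => poissonSeqLaw α with hP
  have hm : 0 < m := by
    rcases Nat.eq_zero_or_pos m with rfl | hm
    · norm_num at h
    · exact hm
  have hae := ae_eventually_notMem (tsum_measure_blockHit_ne_top hα h)
  set B : ℕ → Set (Fin m → ℕ+ → ℕ) := fun k => {X | ∀ k', k ≤ k' → X ∉ blockHit m k'} with hB
  have hex : ∃ k, P (B k) ≠ 0 := by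
    by_contra! hcon
    have h0 : P (⋃ k, B k) = 0 := measure_iUnion_null hcon
    have h1 : ∀ᵐ X ∂P, X ∈ ⋃ k, B k := by
      filter_upwards [hae] with X hX
      obtain ⟨k, hk⟩ := Filter.eventually_atTop.1 hX
      exact Set.mem_iUnion.2 ⟨k, hk⟩
    obtain ⟨X, hX1, hX2⟩ := (h1.and (measure_eq_zero_iff_ae_notMem.1 h0)).exists
    exact hX2 hX1
  obtain ⟨k, hk⟩ := hex
  refine pos_iff_ne_zero.2 (measure_ne_zero_of_preimage_zeroUpTo hα.le (N := 2 ^ k) ?_)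
  refine fun h0 => hk (measure_mono_null (fun X hX => ?_) h0)
  refine Set.eq_singleton_iff_unique_mem.2
    ⟨Set.mem_iInter.2 fun i => zero_mem_sumset _, fun n hn => ?_⟩
  have hn' := fun i => mem_sumset_zeroUpTo (Set.mem_iInter.1 hn i)
  by_contra hn0
  have hlt : 2 ^ k < n := ((hn' ⟨0, hm⟩).2).resolve_left hn0
  refine hX (Nat.log 2 n) (Nat.le_log_of_pow_le one_lt_two hlt.le) ⟨n, mem_Ico.2 ⟨?_, ?_⟩,
    fun i => (hn' i).1⟩
  · exact Nat.pow_log_le_self 2 hn0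
  · exact Nat.lt_pow_succ_log_self one_lt_two n

/-! ### The number of copies -/

lemma trivialInterProb_zero (α : ℝ) : trivialInterProb α 0 = 0 := by
  have : {X : Fin 0 → ℕ+ → ℕ | (⋂ i, sumset (X i)) = {0}} = ∅ := by
    refine Set.eq_empty_of_forall_notMem fun X hX => ?_
    have h1 : (1 : ℕ) ∈ ⋂ i, sumset (X i) := Set.mem_iInter.2 fun i => i.elim0
    rw [show (⋂ i, sumset (X i)) = {0} from hX] at h1
    exact one_ne_zero h1
  rw [trivialInterProb, this, measure_empty]

lemma hFun_eq_ceil {α : ℝ} (h : α * Real.log 2 < 1) :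
    hFun α = ((⌈(1 - α * Real.log 2)⁻¹⌉₊ : ℕ) : ℕ∞) :=
  if_pos ((lt_div_iff₀ (Real.log_pos one_lt_two)).2 h)

lemma hFun_eq_top {α : ℝ} (h : 1 ≤ α * Real.log 2) : hFun α = ⊤ :=
  if_neg (not_lt.2 ((div_le_iff₀ (Real.log_pos one_lt_two)).2 h))

lemma hFun_le_sumsetNumber {α : ℝ} (hα : 0 < α) : hFun α ≤ sumsetNumber α := by
  refine le_sInf ?_
  rintro _ ⟨m, rfl, hm⟩
  rcases m with _ | k
  · exact absurd hm (by rw [trivialInterProb_zero]; exact lt_irrefl _)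
  · have h1 : ((k : ℝ) + 1) * (α * Real.log 2) ≤ k := by
      by_contra! hlt
      rw [trivialInterProb_eq_zero hα hlt] at hm
      exact lt_irrefl _ hm
    have hk : (0 : ℝ) ≤ k := k.cast_nonneg
    have h2 : 0 < 1 - α * Real.log 2 := by
      by_contra! hle
      nlinarith
    rw [hFun_eq_ceil (by linarith)]
    refine Nat.cast_le.2 (Nat.ceil_le.2 ?_)
    rw [inv_le_comm₀ h2 (by positivity), inv_le_iff_one_le_mul₀ (by positivity)]
    push_cast
    linarith

lemma sumsetNumber_le {α : ℝ} (hα : 0 < α) (h : α * Real.log 2 < 1) {m : ℕ}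
    (hm : (1 - α * Real.log 2)⁻¹ < m) : sumsetNumber α ≤ m :=
  sInf_le ⟨m, rfl, trivialInterProb_pos hα ((inv_lt_iff_one_lt_mul₀ (by linarith)).1 hm)⟩

/-- At a point of continuity `(1 - α log 2)⁻¹` is not an integer, since the ceiling jumps to the
right of each integer. -/
lemma inv_lt_ceil_of_continuousAt {α : ℝ} (h : α * Real.log 2 < 1) (hc : ContinuousAt hFun α) :
    (1 - α * Real.log 2)⁻¹ < ⌈(1 - α * Real.log 2)⁻¹⌉₊ := by
  refine lt_of_le_of_ne (Nat.le_ceil _) fun heq => ?_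
  set n := ⌈(1 - α * Real.log 2)⁻¹⌉₊ with hn
  have hlog : 0 < Real.log 2 := Real.log_pos one_lt_two
  have h1 : hFun α < ((n + 1 : ℕ) : ℕ∞) := by
    rw [hFun_eq_ceil h, ← hn]
    exact Nat.cast_lt.2 (Nat.lt_succ_self n)
  have h2 : ∀ᶠ β in nhdsWithin α (Set.Ioi α), hFun β < ((n + 1 : ℕ) : ℕ∞) :=
    (hc.eventually (Iio_mem_nhds h1)).filter_mono nhdsWithin_le_nhds
  have h3 : ∀ᶠ β in nhdsWithin α (Set.Ioi α), β < 1 / Real.log 2 :=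
    Filter.Eventually.filter_mono nhdsWithin_le_nhds (Iio_mem_nhds ((lt_div_iff₀ hlog).2 h))
  obtain ⟨β, ⟨hβ2, hβ3⟩, hβ⟩ := ((h2.and h3).and self_mem_nhdsWithin).exists
  have hβ1 : β * Real.log 2 < 1 := (lt_div_iff₀ hlog).1 hβ3
  rw [hFun_eq_ceil hβ1, Nat.cast_lt, Nat.lt_succ_iff, Nat.ceil_le, ← heq] at hβ2
  refine absurd hβ2 (not_le.2 (inv_strictAnti₀ (by linarith) ?_))
  have := mul_lt_mul_of_pos_right (Set.mem_Ioi.1 hβ) hlog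
  linarith

end PoissonSumset

theorem mainTheorem6 (α : ℝ) (hα : 0 < α) :
    (ContinuousAt hFun α → sumsetNumber α = hFun α) ∧
    (¬ ContinuousAt hFun α → hFun α ≤ sumsetNumber α ∧ sumsetNumber α ≤ hFun α + 1) := by
  have hle := PoissonSumset.hFun_le_sumsetNumber hα
  rcases lt_or_ge (α * Real.log 2) 1 with h | h
  · refine ⟨fun hc => le_antisymm ?_ hle, fun _ => ⟨hle, ?_⟩⟩
    · rw [PoissonSumset.hFun_eq_ceil h]
      exact PoissonSumset.sumsetNumber_le hα h (PoissonSumset.inv_lt_ceil_of_continuousAt h hc)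
    · rw [PoissonSumset.hFun_eq_ceil h]
      refine PoissonSumset.sumsetNumber_le (m := ⌈(1 - α * Real.log 2)⁻¹⌉₊ + 1) hα h ?_
      push_cast
      exact lt_of_le_of_lt (Nat.le_ceil _) (lt_add_one _)
  · rw [PoissonSumset.hFun_eq_top h] at hle ⊢
    exact ⟨fun _ => top_le_iff.1 hle, fun _ => ⟨hle, le_top⟩⟩
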